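/- We work over $\mathbf{C}$. Let $n\ge 1$ and $k\ge d\ge 1$ be integers, let $B\subset\mathbf{P}^n$ be a hypersurface of degree $2d$ with equation $g=0$ (not necessarily smooth), and let $\pi:V\to\mathbf{P}^n$ be the double cover branched over $B$, i.e. the hypersurface $y^2=g(x)$ in the weighted projective space $\mathbf{P}(1^{n+1},d)$ with homogeneous coordinates $(x,y)=(x_0,\dots,x_n,y)$, together with $\pi(x:y)=(x)$. Let $L$ be the pull-back to $V$ of the hyperplane class, so that $|kL|$ is the linear system of divisors cut out on $V$ by the weighted homogeneous polynomials of degree $k$ in $(x,y)$. Then the general member $W$ of $|kL|$ (i.e. every member in some non-empty Zariski-open subset of $|kL|$) is reduced and has the following properties. 1. $W$ is not a double cover of some hypersurface in $\mathbf{P}^n$, i.e. $W$ is not the preimage under $\pi$ of a hypersurface. 2. The restriction $\pi|_W$ is birational onto its image, and the image $W^b=\pi(W)$ is a (reduced) hypersurface of degree $2k$. 3. $W^b$ is everywhere tangent to $B$: the two hypersurfaces have no common component, and at each of their common points the Zariski tangent space of $B$ is contained in that of $W^b$. 4. $W^b$ has an ordinary double singularity along a smooth complete intersection $Z$ of type $(k,k-d)$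 (of codimension $2$; $Z=\emptyset$ if $k=d$ or $n=1$): every point of $Z$ is a point of multiplicity exactly two of $W^b$, and at every point of $Z\setminus B$, which is a Zariski-dense subset of $Z$, the tangent cone of $W^b$ consists of two distinct hyperplanes. (Pinch points may occur along $Z\cap B$.) 5. There is a hypersurface $A$ of degree $k$ that contains $Z$ and cuts out on $B$ its contact locus with $W^b$: $A$ contains no component of $B$, and the intersection scheme of $W^b$ and $B$ is twice the divisor cut out by $A$ on $B$; more precisely, if $F$ and $a$ are the equations of $W^b$ and $A$, then $(F,g)=(a^2,g)$ as ideals of $\mathbf{C}[x_0,\dots,x_n]$. -/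

import Mathlib

open MvPolynomial
open scoped LinearAlgebra.Projectivization

noncomputable section

namespace DoubleCover

/-! ### Hypersurfaces in projective space -/

/-- Complex projective `n`-space. -/
abbrev PSpace (n : ℕ) : Type := ℙ ℂ (Fin (n + 1) → ℂ)

/-- The homogeneous coordinate ring `ℂ[x₀, …, xₙ]` of projective `n`-space. -/
abbrev CoordRing (n : ℕ) : Type := MvPolynomial (Fin (n + 1)) ℂ

variable {n d k : ℕ}

/-- The set of points of the hypersurface `f = 0` (used for homogeneous `f`, when the choice of the
representative of a point is irrelevant, see `mk_mem_hypersurface`). -/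
def hypersurface (f : CoordRing n) : Set (PSpace n) := {p | eval p.rep f = 0}

/-- The differential of `f` at (a representative of) the point `p`. -/
def grad (f : CoordRing n) (p : PSpace n) : Fin (n + 1) → ℂ :=
  fun i => eval p.rep (pderiv i f)

/-- The Hessian matrix of `f` at (a representative of) the point `p`. -/
def hessian (f : CoordRing n) (p : PSpace n) : Matrix (Fin (n + 1)) (Fin (n + 1)) ℂ :=
  Matrix.of fun i j => eval p.rep (pderiv i (pderiv j f))

/-- `T ⊆ Z` is Zariski-dense in `Z`: every form that vanishes on `T` vanishes on `Z`. -/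
def IsDenseIn (T Z : Set (PSpace n)) : Prop :=
  T ⊆ Z ∧ ∀ (m : ℕ) (h : CoordRing n), h.IsHomogeneous m → T ⊆ hypersurface h → Z ⊆ hypersurface h

/-- The hypersurface `F = 0` is everywhere tangent to the hypersurface `G = 0`: they have no common
component, and at every common point the (projective, Zariski) tangent space of `G = 0` is contained
in that of `F = 0`. -/
def IsEverywhereTangent (F G : CoordRing n) : Prop :=
  IsRelPrime F G ∧
    ∀ p ∈ hypersurface F ∩ hypersurface G, ∃ c : ℂ, grad F p = c • grad G p

/-- The hypersurface `a = 0` cuts out on `G = 0` the contact locus of `F = 0` and `G = 0`: it contains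
no component of `G = 0`, and the intersection scheme of `F = 0` and `G = 0` is twice the
divisor cut out by `a` on `G = 0`. In particular `a = 0` and `F = 0` have the same points on
`G = 0`. -/
def CutsOutContactLocus (a F G : CoordRing n) : Prop :=
  IsRelPrime a G ∧ Ideal.span {F, G} = Ideal.span {a ^ 2, G}

/-- The scheme `f₁ = f₂ = 0` is a smooth complete intersection: the two hypersurfaces have no common
component, and their differentials are linearly independent at every common point. If `f₂` is a
nonzero constant, the scheme is empty. -/
def IsSmoothCompleteIntersection (f₁ f₂ : CoordRing n) : Prop :=
  IsRelPrime f₁ f₂ ∧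
    ∀ p ∈ hypersurface f₁ ∩ hypersurface f₂, LinearIndependent ℂ ![grad f₁ p, grad f₂ p]

/-- The hypersurface `F = 0` has multiplicity exactly two at `p`. -/
def IsDoublePoint (F : CoordRing n) (p : PSpace n) : Prop :=
  p ∈ hypersurface F ∧ grad F p = 0 ∧ hessian F p ≠ 0

/-- A double point whose tangent cone has rank two, that is, consists of two distinct hyperplanes.
At a point of a smooth codimension two subvariety along which `F = 0` is singular, this means that
`F = 0` consists locally of two smooth branches that meet transversally. -/
def IsOrdinaryDoublePoint (F : CoordRing n) (p : PSpace n) : Prop :=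
  IsDoublePoint F p ∧ (hessian F p).rank = 2

/-- The hypersurface `F = 0` has an ordinary double singularity along the codimension two
subvariety `Z`: every point of `Z` is a double point, and the generic ones are ordinary.
(Pinch points are thus allowed in a proper closed subset.) -/
def HasOrdinaryDoubleLocus (F : CoordRing n) (Z : Set (PSpace n)) : Prop :=
  (∀ p ∈ Z, IsDoublePoint F p) ∧ IsDenseIn {p | p ∈ Z ∧ IsOrdinaryDoublePoint F p} Z

/-! ### The weighted projective space `P(1ⁿ⁺¹, d)` -/

/-- The weights of the homogeneous coordinates `x₀, …, xₙ` (indexed by `some i`) and `y` (indexed by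
`none`). -/
def weight (n d : ℕ) : Option (Fin (n + 1)) → ℕ := fun o => o.elim d (fun _ => 1)

/-- Nonzero vectors `(x, y)` up to `(x, y) ↦ (t x, t ^ d y)`. -/
def weightedSetoid (n d : ℕ) : Setoid {v : Option (Fin (n + 1)) → ℂ // v ≠ 0} where
  r v w := ∃ t : ℂˣ, ∀ o, w.1 o = (t : ℂ) ^ weight n d o * v.1 o
  iseqv :=
    { refl := fun v => ⟨1, fun o => by simp⟩
      symm := by
        rintro v w ⟨t, ht⟩
        refine ⟨t⁻¹, fun o => ?_⟩
        rw [ht o, ← mul_assoc, ← mul_pow]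
        simp
      trans := by
        rintro u v w ⟨t, ht⟩ ⟨s, hs⟩
        refine ⟨s * t, fun o => ?_⟩
        rw [hs o, ht o, ← mul_assoc, Units.val_mul, mul_pow] }

/-- The points of the weighted projective space `P(1ⁿ⁺¹, d)`. -/
def WPSpace (n d : ℕ) : Type := Quotient (weightedSetoid n d)

/-- Homogeneous coordinates of a point of `P(1ⁿ⁺¹, d)`. -/
def WPSpace.rep (p : WPSpace n d) : Option (Fin (n + 1)) → ℂ := (Quotient.out p).1

/-- The polynomial ring `ℂ[x₀, …, xₙ, y]`. -/
abbrev WCoordRing (n : ℕ) : Type := MvPolynomial (Option (Fin (n + 1))) ℂ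

/-! ### Double covers -/

/-- A hypersurface of degree `2d` in projective `n`-space, with `d` positive, given by its
equation. -/
structure Branch (n d : ℕ) where
  eqn : CoordRing n
  isHomogeneous : eqn.IsHomogeneous (2 * d)
  ne_zero : eqn ≠ 0
  pos : 0 < d

namespace Branch

variable (B : Branch n d)

/-- The ideal generated by `y ^ 2 - g(x)`, where `g` is the equation of the branch hypersurface. -/
def coverIdeal : Ideal (WCoordRing n) := Ideal.span {X none ^ 2 - rename some B.eqn}

/-- The double cover `V` of projective space branched over `B`: the hypersurface `y ^ 2 = g(x)` in
`P(1ⁿ⁺¹, d)`. -/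
def Cover : Type := {p : WPSpace n d // ∀ P ∈ B.coverIdeal, eval p.rep P = 0}

/-- Homogeneous coordinates `(x, y)` of a point of `V`. -/
def rep (p : B.Cover) : Option (Fin (n + 1)) → ℂ := p.1.rep

theorem rep_none_sq (p : B.Cover) : B.rep p none ^ 2 = eval (B.rep p ∘ some) B.eqn := by
  have h := p.2 _ (Ideal.subset_span rfl)
  rw [map_sub, map_pow, eval_X, eval_rename, sub_eq_zero] at h
  exact h

theorem rep_comp_some_ne_zero (p : B.Cover) : B.rep p ∘ some ≠ 0 := by
  intro h0
  have h1 := B.rep_none_sq p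
  have h2 : eval (0 : Fin (n + 1) → ℂ) B.eqn = 0 := by
    have h3 : coeff 0 B.eqn = 0 := B.isHomogeneous.coeff_eq_zero (by
      have := B.pos
      simp
      omega)
    rw [show eval (0 : Fin (n + 1) → ℂ) B.eqn = constantCoeff B.eqn by simp]
    exact h3
  rw [h0, h2] at h1
  refine (Quotient.out p.1).2 (funext fun o => ?_)
  cases o with
  | none => exact pow_eq_zero_iff (two_ne_zero) |>.1 h1
  | some i => exact congrFun h0 i

/-- The double covering `π : V → Pⁿ`, `(x : y) ↦ (x)`. -/
def proj (p : B.Cover) : PSpace n :=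
  Projectivization.mk ℂ (B.rep p ∘ some) (B.rep_comp_some_ne_zero p)

/-- The space of sections `H⁰(V, kL)`, where `L` is the pull-back to `V` of the hyperplane class: the
weighted `k`-ics in `(x, y)` modulo `y ^ 2 - g(x)`. -/
def sections (k : ℕ) : Submodule ℂ (WCoordRing n ⧸ B.coverIdeal) :=
  (weightedHomogeneousSubmodule ℂ (weight n d) k).map
    (Ideal.Quotient.mkₐ ℂ B.coverIdeal).toLinearMap

/-- The ideal in `ℂ[x, y]` of the divisor on `V` of a section `s` of `kL`. -/
def memberIdeal (s : B.sections k) : Ideal (WCoordRing n) :=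
  (Ideal.span {(s : WCoordRing n ⧸ B.coverIdeal)}).comap (Ideal.Quotient.mk B.coverIdeal)

/-- The set of points of the member of `|kL|` defined by the section `s`. -/
def member (s : B.sections k) : Set B.Cover := {p | ∀ P ∈ B.memberIdeal s, eval (B.rep p) P = 0}

/-- The general member of `|kL|` has the property `Q`: the property holds for all nonzero sections
outside the zero locus of some nonzero polynomial function on `H⁰(V, kL)`. -/
def ForGeneralMember (k : ℕ) (Q : B.sections k → Prop) : Prop :=
  ∃ Φ : B.sections k → ℂ,
    Φ ∈ Algebra.adjoin ℂ
      (Set.range fun l : Module.Dual ℂ (B.sections k) => (l : B.sections k → ℂ)) ∧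
    Φ ≠ 0 ∧ ∀ s : B.sections k, s ≠ 0 → Φ s ≠ 0 → Q s

/-- `W` is a double cover of some hypersurface of projective space: it is the preimage under `π` of a
hypersurface. -/
def IsDoubleCoverOfHypersurface (W : Set B.Cover) : Prop :=
  ∃ (m : ℕ) (a : CoordRing n), a.IsHomogeneous m ∧ a ≠ 0 ∧ W = B.proj ⁻¹' hypersurface a

/-- `T ⊆ W` is Zariski-dense in `W`. -/
def IsDenseIn (T W : Set B.Cover) : Prop :=
  T ⊆ W ∧ ∀ (m : ℕ) (P : WCoordRing n), P.IsWeightedHomogeneous (weight n d) m →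
    (∀ p ∈ T, eval (B.rep p) P = 0) → ∀ p ∈ W, eval (B.rep p) P = 0

/-- The restriction of `π` to the (reduced) subvariety `W` is birational onto its image: over the
points of the image where some form `q` is nonzero it has a regular inverse, necessarily of the form
`(x) ↦ (x : p(x) / q(x))`, and the points of `W` where `q` is nonzero are dense in `W` (hence their
images are dense in the image of `W`). -/
def IsBirationalOntoImage (W : Set B.Cover) : Prop :=
  ∃ (m : ℕ) (q p : CoordRing n), q.IsHomogeneous m ∧ p.IsHomogeneous (m + d) ∧
    B.IsDenseIn {w | w ∈ W ∧ B.proj w ∉ hypersurface q} W ∧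
    ∀ w ∈ W, B.proj w ∉ hypersurface q →
      B.rep w none * eval (B.rep w ∘ some) q = eval (B.rep w ∘ some) p

end Branch

/-! ### Independence of the choice of coordinates -/

theorem mk_mem_hypersurface {m : ℕ} {f : CoordRing n} (hf : f.IsHomogeneous m)
    (v : Fin (n + 1) → ℂ) (hv : v ≠ 0) :
    Projectivization.mk ℂ v hv ∈ hypersurface f ↔ eval v f = 0 := by
  obtain ⟨a, ha⟩ := Projectivization.exists_smul_eq_mk_rep ℂ v hv
  have key : eval (Projectivization.mk ℂ v hv).rep f = (a : ℂ) ^ m * eval v f := by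
    rw [← ha, eval_eq, eval_eq, Finset.mul_sum]
    refine Finset.sum_congr rfl fun e he => ?_
    have hdeg : ∑ i ∈ e.support, e i = m := by
      have := hf.degree_eq_sum_deg_support he
      simpa [Finsupp.degree] using this.symm
    simp only [Pi.smul_apply, Units.smul_def, smul_eq_mul, mul_pow, Finset.prod_mul_distrib,
      Finset.prod_pow_eq_pow_sum, hdeg]
    ring
  simp [hypersurface, key]

end DoubleCover

end

/-! Modulo `y ^ 2 = g` every section of `kL` is `f₁ + y f₂` for a unique pair of forms of degrees
`k` and `e = k - d`. Its norm `F = f₁ ^ 2 - g f₂ ^ 2` is the equation of the image, and `y = -f₁ /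
f₂` inverts the projection where `f₂ ≠ 0`. The geometry is read off this formula. Modulo `g` it is
`f₁ ^ 2`, so the image touches `B` along `f₁ = 0`. On `Z`, given by `f₁ = f₂ = 0`, its gradient
vanishes and its Hessian is `2 (∇f₁ ∇f₁ᵀ - g ∇f₂ ∇f₂ᵀ)`, of rank two off `B` when the gradients are
independent.

What remains is that a general pair satisfies `FormPair.IsGeneral`. By `generic_of_no_common_zero`,
absence of nontrivial common zeros is an open condition on forms, so each condition needs only one
example, once it is phrased in these terms. Coprimality and squarefreeness can be tested on a line,
because a nonconstant factor of a form has a zero on every line. Smoothness of `Z` is a Jacobian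
condition, with a weighted Fermat pair as example. That no component of `Z` lies in `B` follows from
a system of parameters containing `g, f₁, f₂` and going-down (`vanishes_of_mul_vanishes`).

The passage from points to ideals rests on `mem_memberIdeal_of_dvd`: divisibility by the squarefree
norm controls membership in the ideal of `W`. -/

noncomputable section

namespace DoubleCover

/-! ### Generic properties of the points of a vector space -/

section Generic

variable {E : Type*} [AddCommGroup E] [Module ℂ E] {σ : Type*}

/-- The algebra of polynomial functions on a vector space. -/
abbrev polyFun (E : Type*) [AddCommGroup E] [Module ℂ E] : Subalgebra ℂ (E → ℂ) :=
  Algebra.adjoin ℂ (Set.range fun l : Module.Dual ℂ E => (l : E → ℂ))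

theorem linear_mem_polyFun (l : E →ₗ[ℂ] ℂ) : (fun s => l s) ∈ polyFun E :=
  Algebra.subset_adjoin ⟨l, rfl⟩

theorem const_mem_polyFun (c : ℂ) : (fun _ => c) ∈ polyFun E :=
  (polyFun E).algebraMap_mem c

theorem exists_polynomial_restrict_line {Φ : E → ℂ} (hΦ : Φ ∈ polyFun E) (s t : E) :
    ∃ p : Polynomial ℂ, ∀ z : ℂ, Φ (s + z • t) = p.eval z := by
  induction hΦ using Algebra.adjoin_induction with
  | mem x hx =>
    obtain ⟨l, rfl⟩ := hx
    exact ⟨Polynomial.C (l s) + Polynomial.X * Polynomial.C (l t), fun z => by simp; ring⟩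
  | algebraMap r => exact ⟨Polynomial.C r, fun z => by simp⟩
  | add x y _ _ hx hy =>
    obtain ⟨p, hp⟩ := hx
    obtain ⟨q, hq⟩ := hy
    exact ⟨p + q, fun z => by simp [hp, hq]⟩
  | mul x y _ _ hx hy =>
    obtain ⟨p, hp⟩ := hx
    obtain ⟨q, hq⟩ := hy
    exact ⟨p * q, fun z => by simp [hp, hq]⟩

/-- On the line joining a point where `Φ ≠ 0` to one where `Ψ ≠ 0`, both restrict to nonzero
polynomials in one variable. This avoids bases and finite dimension. -/
theorem polyFun_mul_ne_zero {Φ Ψ : E → ℂ} (hΦ : Φ ∈ polyFun E) (hΨ : Ψ ∈ polyFun E)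
    (hΦ0 : Φ ≠ 0) (hΨ0 : Ψ ≠ 0) : Φ * Ψ ≠ 0 := by
  obtain ⟨s, hs⟩ := Function.ne_iff.1 hΦ0
  obtain ⟨t, ht⟩ := Function.ne_iff.1 hΨ0
  obtain ⟨p, hp⟩ := exists_polynomial_restrict_line hΦ s (t - s)
  obtain ⟨q, hq⟩ := exists_polynomial_restrict_line hΨ s (t - s)
  have hp0 : p ≠ 0 := by
    rintro rfl
    exact hs (by simpa using hp 0)
  have hq0 : q ≠ 0 := by
    rintro rfl
    exact ht (by simpa using hq 1)
  obtain ⟨z, hz⟩ : ∃ z, (p * q).eval z ≠ 0 := by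
    by_contra! h
    exact mul_ne_zero hp0 hq0 (Polynomial.funext fun z => by simpa using h z)
  intro h
  refine hz ?_
  rw [Polynomial.eval_mul, ← hp, ← hq]
  exact congrFun h _

/-- A property holds for the general point of a vector space. -/
def Generic (Q : E → Prop) : Prop :=
  ∃ Φ ∈ polyFun E, Φ ≠ 0 ∧ ∀ s, Φ s ≠ 0 → Q s

theorem Generic.mono {Q R : E → Prop} (h : Generic Q) (hQR : ∀ s, Q s → R s) : Generic R := by
  obtain ⟨Φ, h1, h2, h3⟩ := h
  exact ⟨Φ, h1, h2, fun s hs => hQR s (h3 s hs)⟩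

theorem Generic.and {Q R : E → Prop} (hQ : Generic Q) (hR : Generic R) :
    Generic fun s => Q s ∧ R s := by
  obtain ⟨Φ, h1, h2, h3⟩ := hQ
  obtain ⟨Ψ, k1, k2, k3⟩ := hR
  exact ⟨Φ * Ψ, mul_mem h1 k1, polyFun_mul_ne_zero h1 k1 h2 k2, fun s hs =>
    ⟨h3 s (left_ne_zero_of_mul hs), k3 s (right_ne_zero_of_mul hs)⟩⟩

theorem polyFun_comp_linear {E' : Type*} [AddCommGroup E'] [Module ℂ E'] (e : E' →ₗ[ℂ] E)
    {Φ : E → ℂ} (hΦ : Φ ∈ polyFun E) : Φ ∘ e ∈ polyFun E' := by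
  induction hΦ using Algebra.adjoin_induction with
  | mem x hx =>
    obtain ⟨l, rfl⟩ := hx
    exact linear_mem_polyFun (l ∘ₗ e)
  | algebraMap r => exact const_mem_polyFun r
  | add x y _ _ hx hy => exact add_mem hx hy
  | mul x y _ _ hx hy => exact mul_mem hx hy

theorem Generic.comp_equiv {E' : Type*} [AddCommGroup E'] [Module ℂ E'] (e : E' ≃ₗ[ℂ] E)
    {Q : E → Prop} (h : Generic Q) : Generic fun s : E' => Q (e s) := by
  obtain ⟨Φ, h1, h2, h3⟩ := h
  refine ⟨Φ ∘ e, polyFun_comp_linear e.toLinearMap h1, fun h0 => h2 ?_, fun s hs => h3 _ hs⟩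
  funext s
  simpa using congrFun h0 (e.symm s)

/-- A family of polynomials whose coefficients are polynomial functions of the parameter. -/
def IsPolyFamily (h : E → MvPolynomial σ ℂ) : Prop :=
  ∀ m, (fun s => coeff m (h s)) ∈ polyFun E

namespace IsPolyFamily

variable {h h' : E → MvPolynomial σ ℂ}

theorem const (p : MvPolynomial σ ℂ) : IsPolyFamily fun _ : E => p :=
  fun m => const_mem_polyFun (coeff m p)

theorem linear (l : E →ₗ[ℂ] MvPolynomial σ ℂ) : IsPolyFamily fun s => l s :=
  fun m => linear_mem_polyFun (lcoeff ℂ m ∘ₗ l)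

theorem add (hh : IsPolyFamily h) (hh' : IsPolyFamily h') : IsPolyFamily fun s => h s + h' s :=
  fun m => by
    simp only [coeff_add]
    exact add_mem (hh m) (hh' m)

theorem sub (hh : IsPolyFamily h) (hh' : IsPolyFamily h') : IsPolyFamily fun s => h s - h' s :=
  fun m => by
    simp only [coeff_sub]
    exact sub_mem (hh m) (hh' m)

theorem sum {ι : Type*} (t : Finset ι) {f : ι → E → MvPolynomial σ ℂ}
    (hf : ∀ i ∈ t, IsPolyFamily (f i)) : IsPolyFamily fun s => ∑ i ∈ t, f i s := fun m => by
  simp only [coeff_sum]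
  have := sum_mem (S := polyFun E) (t := t) (f := fun i s => coeff m (f i s)) fun i hi => hf i hi m
  convert this using 1
  funext s
  simp

theorem mul (hh : IsPolyFamily h) (hh' : IsPolyFamily h') : IsPolyFamily fun s => h s * h' s :=
  fun m => by
    classical
    simp only [coeff_mul]
    have := sum_mem (S := polyFun E) (t := Finset.HasAntidiagonal.antidiagonal m)
      (f := fun x s => coeff x.1 (h s) * coeff x.2 (h' s)) fun x _ => mul_mem (hh x.1) (hh' x.2)
    convert this using 1
    funext s
    simp

theorem pow (hh : IsPolyFamily h) (N : ℕ) : IsPolyFamily fun s => h s ^ N := by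
  induction N with
  | zero => simpa using const (E := E) 1
  | succ N ih => simpa only [pow_succ] using ih.mul hh

theorem pderiv (hh : IsPolyFamily h) (i : σ) :
    IsPolyFamily fun s => MvPolynomial.pderiv i (h s) := fun m => by
  classical
  simp only [coeff_pderiv]
  exact mul_mem (hh _) (const_mem_polyFun _)

end IsPolyFamily

end Generic

/-! ### Forms without common zeros -/

section Forms

theorem homogeneousComponent_mul_of_le {σ : Type*} {p q : MvPolynomial σ ℂ} {D M : ℕ} (hq : q.IsHomogeneous D)
    (h : D ≤ M) : homogeneousComponent M (p * q) = homogeneousComponent (M - D) p * q := by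
  let _ := MvPolynomial.gradedAlgebra (σ := σ) (R := ℂ)
  have := DirectSum.coe_decompose_mul_of_right_mem_of_le (𝒜 := homogeneousSubmodule σ ℂ) (a := p)
    ((mem_homogeneousSubmodule D q).2 hq) h
  rw [← decomposition.decompose'_apply, ← decomposition.decompose'_apply]
  exact this

variable {σ : Type*} [Fintype σ] {J : Type*} [Fintype J]

/-- If a finite family of forms has no common zeros, then the monomials of large degree are
combinations of these forms with homogeneous coefficients. -/
theorem exists_monomial_eq_sum {D : J → ℕ} {h : J → MvPolynomial σ ℂ}
    (hh : ∀ j, (h j).IsHomogeneous (D j))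
    (h0 : ∀ x : σ → ℂ, (∀ j, eval x (h j) = 0) → x = 0) :
    ∃ M : ℕ, ∀ e : σ →₀ ℕ, M ≤ e.degree → ∃ c : J → MvPolynomial σ ℂ,
      (∀ j, (c j).IsHomogeneous (e.degree - D j)) ∧ (∀ j, D j ≤ e.degree) ∧
      monomial e 1 = ∑ j, c j * h j := by
  classical
  -- Nullstellensatz: the ideal of the family contains a power of the irrelevant ideal.
  have hle : idealOfVars σ ℂ ≤ (Ideal.span (Set.range h)).radical := by
    rw [← vanishingIdeal_zeroLocus_eq_radical (K := ℂ), idealOfVars, Ideal.span_le]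
    rintro _ ⟨i, rfl⟩
    rw [SetLike.mem_coe, mem_vanishingIdeal_iff]
    intro x hx
    rw [mem_zeroLocus_iff] at hx
    have : x = 0 := h0 x fun j => by
      simpa [aeval_eq_eval] using hx _ (Ideal.subset_span ⟨j, rfl⟩)
    simp [this]
  obtain ⟨N, hN⟩ := Ideal.exists_pow_le_of_le_radical_of_fg hle (idealOfVars_fg σ ℂ)
  -- The summand `∑ j, D j` ensures `D j ≤ e.degree`, so the subtraction `e.degree - D j` is not
  -- truncated.
  refine ⟨N + ∑ j, D j, fun e he => ?_⟩
  have hD : ∀ j, D j ≤ e.degree := fun j =>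
    (Finset.single_le_sum (f := D) (fun _ _ => Nat.zero_le _) (Finset.mem_univ j)).trans (by omega)
  have hmem : monomial e (1 : ℂ) ∈ Ideal.span (Set.range h) :=
    hN ((monomial_mem_pow_idealOfVars_iff N e one_ne_zero).2 (by omega))
  obtain ⟨c, hc⟩ := (Ideal.mem_span_range_iff_exists_fun).1 hmem
  refine ⟨fun j => homogeneousComponent (e.degree - D j) (c j),
    fun j => homogeneousComponent_isHomogeneous _ _, hD, ?_⟩
  have h1 : homogeneousComponent e.degree (monomial e (1 : ℂ)) = monomial e 1 :=
    homogeneousComponent_eq_self (isHomogeneous_monomial _ rfl)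
  rw [← h1, ← hc, map_sum]
  exact Finset.sum_congr rfl fun j _ => homogeneousComponent_mul_of_le (hh j) (hD j)

/-- Forms depending polynomially on a parameter have no common zeros for general values of the
parameter if they have none for one value. -/
theorem generic_of_no_common_zero {E : Type*} [AddCommGroup E] [Module ℂ E] {D : J → ℕ}
    {h : J → E → MvPolynomial σ ℂ} (hh : ∀ j s, (h j s).IsHomogeneous (D j))
    (hpoly : ∀ j, IsPolyFamily (h j)) (s₀ : E)
    (h0 : ∀ x : σ → ℂ, (∀ j, eval x (h j s₀) = 0) → x = 0) :
    Generic fun s => ∀ x : σ → ℂ, (∀ j, eval x (h j s) = 0) → x = 0 := by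
  classical
  obtain ⟨M, hM⟩ := exists_monomial_eq_sum (fun j => hh j s₀) h0
  let I := {e : σ →₀ ℕ // e ∈ Finset.finsuppAntidiag (Finset.univ : Finset σ) M}
  have hI : ∀ e : I, e.1.degree = M := fun e => by
    have := (Finset.mem_finsuppAntidiag.1 e.2).1
    rw [Finsupp.degree_eq_sum]
    exact this
  choose c hc hD hsum using fun e : I => hM e.1 (hI e).ge
  -- The coefficients `c` found at `s₀` are kept while `s` varies. The matrix of the `G e s` in the
  -- monomials of degree `M` is the identity at `s₀`; where its determinant is nonzero, a common
  -- zero of the `h j s` kills every monomial of degree `M`, in particular the pure powers.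
  let G : I → E → MvPolynomial σ ℂ := fun e s => ∑ j, c e j * h j s
  have hG : ∀ e, IsPolyFamily (G e) := fun e =>
    IsPolyFamily.sum _ fun j _ => (IsPolyFamily.const _).mul (hpoly j)
  have hGh : ∀ e s, (G e s).IsHomogeneous M := fun e s =>
    IsHomogeneous.sum _ _ _ fun j _ => by
      have := (hc e j).mul (hh j s)
      rwa [Nat.sub_add_cancel (hD e j), hI e] at this
  let A : E → Matrix I I ℂ := fun s => Matrix.of fun e f => coeff f.1 (G e s)
  refine ⟨fun s => (A s).det, ?_, ?_, ?_⟩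
  · simp only [Matrix.det_apply]
    have := sum_mem (S := polyFun E) (t := (Finset.univ : Finset (Equiv.Perm I)))
      (f := fun τ => ((Equiv.Perm.sign τ : ℤ) : ℂ) • ∏ i : I, fun s => A s (τ i) i)
      fun τ _ => Subalgebra.smul_mem _ (prod_mem fun i _ => hG _ _) _
    convert this using 1
    funext s
    simp [Units.smul_def]
  · intro h
    have h1 : A s₀ = 1 := by
      ext e f
      simp only [A, G, Matrix.of_apply, ← hsum, coeff_monomial, Matrix.one_apply]
      exact if_congr Subtype.ext_iff.symm rfl rfl
    have := congrFun h s₀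
    simp [h1] at this
  · intro s hs x hx
    have hGx : ∀ e, eval x (G e s) = 0 := fun e => by simp [G, hx]
    have hmul : (A s).mulVec (fun f : I => ∏ i, x i ^ f.1 i) = 0 := by
      funext e
      have h1 := hGx e
      rw [eval_eq'] at h1
      rw [Pi.zero_apply, ← h1, Matrix.mulVec, dotProduct]
      simp only [A, Matrix.of_apply]
      rw [Finset.sum_coe_sort (Finset.finsuppAntidiag (Finset.univ : Finset σ) M)
        (fun f => coeff f (G e s) * ∏ i, x i ^ f i)]
      symm
      refine Finset.sum_subset (fun f hf => ?_) fun f _ hf => ?_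
      · have := (hGh e s).degree_eq_sum_deg_support hf
        rw [Finset.mem_finsuppAntidiag]
        refine ⟨?_, Finset.subset_univ _⟩
        rw [← Finsupp.degree_eq_sum, this, Finsupp.degree_apply]
      · rw [notMem_support_iff.1 hf, zero_mul]
    have hz := Matrix.eq_zero_of_mulVec_eq_zero hs hmul
    funext i
    have h2 := congrFun hz ⟨Finsupp.single i M, by
      rw [Finset.mem_finsuppAntidiag]
      refine ⟨?_, Finset.subset_univ _⟩
      rw [← Finsupp.degree_eq_sum, Finsupp.degree_single]⟩
    rw [Pi.zero_apply, Finset.prod_eq_single i (fun j _ hj => by simp [Finsupp.single_eq_of_ne hj])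
      (by simp)] at h2
    simpa using eq_zero_of_pow_eq_zero h2

end Forms

/-! ### Systems of parameters -/

section Parameters

variable {σ ι : Type*} [Fintype σ] [Fintype ι]

/-- The polynomial ring is integral over the subring generated by forms of positive degree without
common zeros. -/
theorem isIntegral_aeval_of_no_common_zero {D : ι → ℕ} {θ : ι → MvPolynomial σ ℂ}
    (hθ : ∀ i, (θ i).IsHomogeneous (D i)) (hD : ∀ i, 0 < D i)
    (h0 : ∀ x : σ → ℂ, (∀ i, eval x (θ i) = 0) → x = 0) :
    (aeval θ : MvPolynomial ι ℂ →ₐ[ℂ] MvPolynomial σ ℂ).toRingHom.IsIntegral := by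
  classical
  obtain ⟨M, hM⟩ := exists_monomial_eq_sum hθ h0
  let φ : MvPolynomial ι ℂ →+* MvPolynomial σ ℂ :=
    (aeval θ : MvPolynomial ι ℂ →ₐ[ℂ] MvPolynomial σ ℂ).toRingHom
  apply RingHom.Finite.to_isIntegral
  let _ : Module (MvPolynomial ι ℂ) (MvPolynomial σ ℂ) := Module.compHom _ φ
  have hsmul : ∀ (a : MvPolynomial ι ℂ) (p : MvPolynomial σ ℂ), a • p = φ a * p := fun _ _ => rfl
  let T : Finset (MvPolynomial σ ℂ) := (Finset.range M).biUnion fun N =>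
    (Finset.finsuppAntidiag (Finset.univ : Finset σ) N).image fun e => monomial e 1
  let N : Submodule (MvPolynomial ι ℂ) (MvPolynomial σ ℂ) := Submodule.span _ T
  have hC : ∀ (r : ℂ) (p : MvPolynomial σ ℂ), p ∈ N → C r * p ∈ N := fun r p hp => by
    have := N.smul_mem (C r) hp
    rw [hsmul] at this
    simpa [φ] using this
  -- The monomials of degree less than `M` generate the module: a higher one is `∑ c i * θ i`, where
  -- each `c i` has smaller degree because `0 < D i`.
  have hmon : ∀ (k : ℕ) (e : σ →₀ ℕ), e.degree = k → monomial e (1 : ℂ) ∈ N := by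
    intro k
    induction k using Nat.strong_induction_on with
    | _ k ih =>
      intro e he
      by_cases hk : k < M
      · refine Submodule.subset_span ?_
        simp only [T, Finset.coe_biUnion, Set.mem_iUnion, Finset.mem_coe, Finset.mem_image,
          Finset.mem_range]
        refine ⟨k, hk, e, ?_, rfl⟩
        rw [Finset.mem_finsuppAntidiag]
        exact ⟨by rw [← he, Finsupp.degree_eq_sum], Finset.subset_univ _⟩
      · obtain ⟨c, hc, hDe, hsum⟩ := hM e (by omega)
        rw [hsum]
        refine sum_mem fun i _ => ?_
        have hci : c i ∈ N := by
          rw [(c i).as_sum]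
          refine sum_mem fun f hf => ?_
          have hdeg := (hc i).degree_eq_sum_deg_support hf
          have := ih f.degree (by
            have := hD i
            have := hDe i
            rw [Finsupp.degree_apply]
            omega) f rfl
          have h2 := hC (coeff f (c i)) _ this
          rwa [C_mul_monomial, mul_one] at h2
        have := N.smul_mem (X i) hci
        rw [hsmul] at this
        simpa [φ, mul_comm] using this
  have htop : N = ⊤ := by
    rw [eq_top_iff]
    intro p _
    rw [p.as_sum]
    refine sum_mem fun e _ => ?_
    have := hC (coeff e p) _ (hmon _ e rfl)
    rwa [C_mul_monomial, mul_one] at this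
  have hfin : Module.Finite (MvPolynomial ι ℂ) (MvPolynomial σ ℂ) := ⟨⟨T, htop⟩⟩
  exact hfin

/-- As many forms of positive degree without common zeros as there are variables are algebraically
independent. -/
theorem algebraicIndependent_of_no_common_zero (hcard : Fintype.card ι = Fintype.card σ)
    {D : ι → ℕ} {θ : ι → MvPolynomial σ ℂ}
    (hθ : ∀ i, (θ i).IsHomogeneous (D i)) (hD : ∀ i, 0 < D i)
    (h0 : ∀ x : σ → ℂ, (∀ i, eval x (θ i) = 0) → x = 0) : AlgebraicIndependent ℂ θ := by
  have hint := isIntegral_aeval_of_no_common_zero hθ hD h0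
  have halg : Algebra.IsAlgebraic (Algebra.adjoin ℂ (Set.range θ)) (MvPolynomial σ ℂ) := by
    have : Algebra.IsIntegral (Algebra.adjoin ℂ (Set.range θ)) (MvPolynomial σ ℂ) := by
      refine ⟨fun p => ?_⟩
      obtain ⟨q, hq, hq0⟩ := hint p
      let ψ : MvPolynomial ι ℂ →+* Algebra.adjoin ℂ (Set.range θ) :=
        ((aeval θ : MvPolynomial ι ℂ →ₐ[ℂ] MvPolynomial σ ℂ).codRestrict _ fun a => by
          rw [Algebra.adjoin_range_eq_range_aeval]
          exact ⟨a, rfl⟩).toRingHom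
      refine ⟨q.map ψ, hq.map ψ, ?_⟩
      rw [Polynomial.eval₂_map]
      exact hq0
    infer_instance
  -- The ring is algebraic over the forms, and there are no more forms than its transcendence
  -- degree.
  have htb : IsTranscendenceBasis ℂ θ := by
    refine Algebra.IsAlgebraic.isTranscendenceBasis_of_lift_le_trdeg_of_finite ℂ θ ?_
    rw [MvPolynomial.trdeg_of_isDomain]
    simp [hcard]
  exact htb.1

/-- The ideal is the kernel of the substitution killing both variables, which maps into a domain. -/
theorem isPrime_span_X_pair {ι : Type*} {a b : ι} :
    (Ideal.span {X a, X b} : Ideal (MvPolynomial ι ℂ)).IsPrime := by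
  classical
  let ψ : MvPolynomial ι ℂ →ₐ[ℂ] MvPolynomial ι ℂ :=
    aeval fun i => if i = a ∨ i = b then 0 else X i
  have : (Ideal.span {X a, X b} : Ideal (MvPolynomial ι ℂ)) = RingHom.ker ψ := by
    refine le_antisymm ?_ fun p hp => ?_
    · rw [Ideal.span_le]
      rintro _ (rfl | rfl) <;> simp [ψ]
    · have key : ∀ q : MvPolynomial ι ℂ,
          Ideal.Quotient.mk (Ideal.span {X a, X b}) (ψ q) = Ideal.Quotient.mk _ q := fun q => by
        suffices h : (Ideal.Quotient.mkₐ ℂ (Ideal.span {X a, X b})).comp ψ =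
            Ideal.Quotient.mkₐ ℂ _ from DFunLike.congr_fun h q
        refine algHom_ext fun i => ?_
        simp only [AlgHom.comp_apply, ψ, aeval_X]
        split_ifs with h
        · rw [map_zero]
          symm
          rw [Ideal.Quotient.mkₐ_eq_mk, Ideal.Quotient.eq_zero_iff_mem]
          exact Ideal.subset_span (by rcases h with rfl | rfl <;> simp)
        · rfl
      rw [← Ideal.Quotient.eq_zero_iff_mem, ← key, (RingHom.mem_ker).1 hp, map_zero]
  rw [this]
  exact RingHom.ker_isPrime _

/-- If as many forms of positive degree as there are variables have no common zeros, then none of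
them vanishes on a component of the common zero locus of two others. -/
theorem vanishes_of_mul_vanishes (hcard : Fintype.card ι = Fintype.card σ)
    {D : ι → ℕ} {θ : ι → MvPolynomial σ ℂ}
    (hθ : ∀ i, (θ i).IsHomogeneous (D i)) (hD : ∀ i, 0 < D i)
    (h0 : ∀ x : σ → ℂ, (∀ i, eval x (θ i) = 0) → x = 0) {a b c : ι} (hca : c ≠ a) (hcb : c ≠ b)
    {h : MvPolynomial σ ℂ}
    (hh : ∀ x, eval x (θ a) = 0 → eval x (θ b) = 0 → eval x (h * θ c) = 0)
    (x : σ → ℂ) (hxa : eval x (θ a) = 0) (hxb : eval x (θ b) = 0) : eval x h = 0 := by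
  classical
  have hint := isIntegral_aeval_of_no_common_zero hθ hD h0
  have hinj : Function.Injective (aeval θ : MvPolynomial ι ℂ →ₐ[ℂ] MvPolynomial σ ℂ) :=
    algebraicIndependent_of_no_common_zero hcard hθ hD h0
  let J : Ideal (MvPolynomial σ ℂ) := Ideal.span {θ a, θ b}
  have hJ : ∀ p, p ∈ J.radical ↔ ∀ x, eval x (θ a) = 0 → eval x (θ b) = 0 → eval x p = 0 := by
    intro p
    rw [← vanishingIdeal_zeroLocus_eq_radical (K := ℂ), mem_vanishingIdeal_iff]
    simp [J, zeroLocus_span, aeval_eq_eval]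
  refine (hJ h).1 ?_ x hxa hxb
  have hmem := (hJ _).2 hh
  rw [← Ideal.sInf_minimalPrimes, Ideal.mem_sInf] at hmem ⊢
  intro P hP
  have hPp : P.IsPrime := hP.1.1
  -- It must be shown that `θ c` lies in no minimal prime `P` over `J`. Otherwise `P` contracts to a
  -- prime strictly above `(X a, X b)`, and going-down yields a smaller prime still containing `J`,
  -- against minimality.
  refine (hPp.mem_or_mem (hmem hP)).resolve_right fun hc => ?_
  let _ : Algebra (MvPolynomial ι ℂ) (MvPolynomial σ ℂ) :=
    (aeval θ : MvPolynomial ι ℂ →ₐ[ℂ] MvPolynomial σ ℂ).toRingHom.toAlgebra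
  have hmap : ∀ p : MvPolynomial ι ℂ, algebraMap _ (MvPolynomial σ ℂ) p = aeval θ p := fun _ => rfl
  have : FaithfulSMul (MvPolynomial ι ℂ) (MvPolynomial σ ℂ) :=
    (faithfulSMul_iff_algebraMap_injective _ _).2 hinj
  have : Algebra.IsIntegral (MvPolynomial ι ℂ) (MvPolynomial σ ℂ) := ⟨hint⟩
  have := isPrime_span_X_pair (a := a) (b := b)
  have hmemP : ∀ i, θ i ∈ P → X i ∈ P.under (MvPolynomial ι ℂ) := fun i hi => by
    rw [Ideal.under_def, Ideal.mem_comap, hmap, aeval_X]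
    exact hi
  have hab : ∀ {Q : Ideal (MvPolynomial σ ℂ)}, J ≤ Q ↔ θ a ∈ Q ∧ θ b ∈ Q := fun {Q} => by
    simp [J, Ideal.span_le, Set.insert_subset_iff]
  have hJP := hab.1 hP.1.2
  have hlt : Ideal.span {X a, X b} < P.under (MvPolynomial ι ℂ) := by
    refine lt_of_le_of_ne ?_ fun heq => ?_
    · rw [Ideal.span_le]
      rintro _ (rfl | rfl)
      exacts [hmemP _ hJP.1, hmemP _ hJP.2]
    · have h1 := hmemP c hc
      rw [← heq, ← Set.image_pair X a b, mem_ideal_span_X_image] at h1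
      obtain ⟨i, hi, hne⟩ := h1 (Finsupp.single c 1) (by simp [mem_support_iff])
      refine hne (Finsupp.single_eq_of_ne ?_)
      rcases hi with rfl | rfl
      exacts [hca.symm, hcb.symm]
  obtain ⟨Q, hQP, hQ, hQl⟩ := Ideal.exists_ideal_lt_liesOver_of_lt (q := P.under _) P hlt
  have hQmem : ∀ i, X i ∈ (Ideal.span {X a, X b} : Ideal (MvPolynomial ι ℂ)) → θ i ∈ Q :=
    fun i hi => by
      rw [hQl.over, Ideal.under_def, Ideal.mem_comap, hmap, aeval_X] at hi
      exact hi
  exact hQP.not_ge (hP.2 ⟨hQ, hab.2 ⟨hQmem a (Ideal.subset_span (by simp)),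
    hQmem b (Ideal.subset_span (by simp))⟩⟩ hQP.le)

end Parameters

/-! ### Values of forms and their factors -/

section Factors

variable {σ : Type*}

theorem eval_weighted_scale {w : σ → ℕ} {P : MvPolynomial σ ℂ} {m : ℕ}
    (hP : P.IsWeightedHomogeneous w m) (t : ℂ) (x : σ → ℂ) :
    eval (fun i => t ^ w i * x i) P = t ^ m * eval x P := by
  rw [eval_eq, eval_eq, Finset.mul_sum]
  refine Finset.sum_congr rfl fun e he => ?_
  have h : ∑ i ∈ e.support, w i * e i = m := by
    rw [← hP (mem_support_iff.1 he), Finsupp.weight_apply, Finsupp.sum]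
    simp [mul_comm]
  simp only [mul_pow, Finset.prod_mul_distrib, ← pow_mul, Finset.prod_pow_eq_pow_sum, h]
  ring

theorem eval_smul_of_isHomogeneous {F : MvPolynomial σ ℂ} {m : ℕ} (hF : F.IsHomogeneous m) (t : ℂ)
    (x : σ → ℂ) : eval (t • x) F = t ^ m * eval x F := by
  rw [← eval_weighted_scale hF t x]
  congr 1
  congr 1
  funext i
  simp

theorem exists_polynomial_eval_line (F : MvPolynomial σ ℂ) (u v : σ → ℂ) :
    ∃ p : Polynomial ℂ, ∀ t, p.eval t = eval (u + t • v) F := by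
  refine ⟨aeval (fun i => Polynomial.C (u i) + Polynomial.C (v i) * Polynomial.X) F, fun t => ?_⟩
  induction F using MvPolynomial.induction_on with
  | C a => simp
  | add p q hp hq => simp [hp, hq]
  | mul_X p i hp =>
    simp only [map_mul, Polynomial.eval_mul, hp, aeval_X, eval_X]
    simp
    left
    ring

/-- A factor of a form is a form (in the sense that its values scale). -/
theorem exists_eval_smul_of_dvd {F h : MvPolynomial σ ℂ} {m : ℕ} (hF : F.IsHomogeneous m)
    (hF0 : F ≠ 0) (hh : h ∣ F) :
    ∃ e : ℕ, (∀ (t : ℂ) (x : σ → ℂ), eval (t • x) h = t ^ e * eval x h) ∧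
      (¬ IsUnit h → 0 < e) := by
  -- The map `p(x) ↦ p(T x)` sends `F` to `F T ^ m`. Degree and trailing degree in `T` are both
  -- additive, so each factor of `F` must also go to a monomial in `T`.
  let θ : MvPolynomial σ ℂ →ₐ[ℂ] Polynomial (MvPolynomial σ ℂ) :=
    aeval fun i => Polynomial.C (X i) * Polynomial.X
  have hθ : ∀ (p r : MvPolynomial σ ℂ) (x : σ → ℂ),
      eval x ((θ p).eval r) = eval (eval x r • x) p := fun p r x => by
    induction p using MvPolynomial.induction_on with
    | C a => simp [θ, Polynomial.algebraMap_apply, MvPolynomial.algebraMap_eq]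
    | add p q hp hq => simp [hp, hq]
    | mul_X p i hp =>
      rw [map_mul, Polynomial.eval_mul, map_mul, hp, map_mul, eval_X]
      simp only [θ, aeval_X, Polynomial.eval_mul, Polynomial.eval_C, Polynomial.eval_X, map_mul,
        eval_X, Pi.smul_apply, smul_eq_mul]
      ring
  have hθF : θ F = Polynomial.C F * Polynomial.X ^ m := by
    refine Polynomial.funext fun r => MvPolynomial.funext fun x => ?_
    rw [hθ, eval_smul_of_isHomogeneous hF]
    simp only [Polynomial.eval_mul, Polynomial.eval_C, Polynomial.eval_pow, Polynomial.eval_X,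
      map_mul, map_pow]
    ring
  obtain ⟨q, rfl⟩ := hh
  have hne : θ h * θ q ≠ 0 := by
    rw [← map_mul, hθF]
    exact mul_ne_zero (Polynomial.C_ne_zero.2 hF0) (pow_ne_zero _ Polynomial.X_ne_zero)
  have hh0 := left_ne_zero_of_mul hne
  have hq0 := right_ne_zero_of_mul hne
  have h1 : (θ h).natDegree + (θ q).natDegree = m := by
    rw [← Polynomial.natDegree_mul hh0 hq0, ← map_mul, hθF, Polynomial.natDegree_C_mul_X_pow _ _ hF0]
  have h2 : (θ h).natTrailingDegree + (θ q).natTrailingDegree = m := by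
    rw [← Polynomial.natTrailingDegree_mul hh0 hq0, ← map_mul, hθF,
      Polynomial.C_mul_X_pow_eq_monomial, Polynomial.natTrailingDegree_monomial hF0]
  have h3 := (θ h).natTrailingDegree_le_natDegree
  have h4 := (θ q).natTrailingDegree_le_natDegree
  have h5 : (θ h).natTrailingDegree = (θ h).natDegree := by omega
  have h6 : θ h = Polynomial.C (θ h).leadingCoeff * Polynomial.X ^ (θ h).natDegree := by
    rw [Polynomial.C_mul_X_pow_eq_monomial]
    ext1 i
    rw [Polynomial.coeff_monomial]
    split_ifs with hi
    · rw [← hi, Polynomial.leadingCoeff]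
    · rcases lt_or_gt_of_ne hi with hi | hi
      · exact Polynomial.coeff_eq_zero_of_natDegree_lt hi
      · exact Polynomial.coeff_eq_zero_of_lt_natTrailingDegree (by omega)
  have key : ∀ (t : ℂ) (x : σ → ℂ),
      eval (t • x) h = t ^ (θ h).natDegree * eval x (θ h).leadingCoeff := fun t x => by
    have h7 := hθ h (C t) x
    rw [eval_C] at h7
    rw [← h7]
    conv_lhs => rw [h6]
    simp only [Polynomial.eval_mul, Polynomial.eval_C, Polynomial.eval_pow, Polynomial.eval_X,
      map_mul, map_pow, eval_C]
    ring
  have key1 : ∀ x, eval x h = eval x (θ h).leadingCoeff := fun x => by simpa using key 1 x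
  refine ⟨(θ h).natDegree, fun t x => by rw [key, key1], fun hu => ?_⟩
  by_contra h0
  have h0' : (θ h).natDegree = 0 := by omega
  refine hu ?_
  have hC : h = C (eval 0 h) := MvPolynomial.funext fun x => by
    have := key 0 x
    rw [h0', pow_zero, one_mul, ← key1, zero_smul] at this
    rw [eval_C, this]
  rw [hC]
  refine (isUnit_iff_ne_zero.2 fun h00 => hF0 ?_).map C
  rw [hC, h00, C_0, zero_mul]

/-- A binary form of positive degree has a nontrivial zero. If `h` restricted to `u + t v` is a
nonzero constant, then homogeneity makes `h (v + s u)` a multiple of `s ^ e`, which forces `h v =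
0`. -/
theorem exists_zero_on_line {h : MvPolynomial σ ℂ} {e : ℕ} (he : 0 < e)
    (hh : ∀ (t : ℂ) (x : σ → ℂ), eval (t • x) h = t ^ e * eval x h) (u v : σ → ℂ) :
    ∃ α β : ℂ, (α ≠ 0 ∨ β ≠ 0) ∧ eval (α • u + β • v) h = 0 := by
  by_cases hv : eval v h = 0
  · exact ⟨0, 1, Or.inr one_ne_zero, by simpa using hv⟩
  obtain ⟨p, hp⟩ := exists_polynomial_eval_line h u v
  by_cases hdeg : p.degree = 0
  · obtain ⟨r, hr⟩ := exists_polynomial_eval_line h v u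
    rw [Polynomial.eq_C_of_degree_eq_zero hdeg] at hp
    have : r = Polynomial.C (p.coeff 0) * Polynomial.X ^ e := by
      refine Polynomial.eq_of_infinite_eval_eq _ _
        ((Set.finite_singleton (0 : ℂ)).infinite_compl.mono fun s hs => ?_)
      have hs : s ≠ 0 := hs
      have h1 : v + s • u = s • (u + s⁻¹ • v) := by
        rw [smul_add, smul_smul, mul_inv_cancel₀ hs, one_smul, add_comm]
      have h2 := hp s⁻¹
      rw [Polynomial.eval_C] at h2
      simp only [Set.mem_ofPred_eq, hr, h1, hh, ← h2, Polynomial.eval_mul, Polynomial.eval_C,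
        Polynomial.eval_pow, Polynomial.eval_X]
      ring
    have h0 := hr 0
    rw [this] at h0
    simp [he.ne'] at h0
    exact absurd h0.symm hv
  · by_cases hp0 : p = 0
    · refine ⟨1, 0, Or.inl one_ne_zero, ?_⟩
      have := hp 0
      rw [hp0] at this
      simpa using this.symm
    obtain ⟨t, ht⟩ := IsAlgClosed.exists_root p hdeg
    refine ⟨1, t, Or.inl one_ne_zero, ?_⟩
    rw [one_smul, ← hp]
    exact ht

theorem isRelPrime_of_no_common_zero_on_line {f F : MvPolynomial σ ℂ} {m : ℕ}
    (hF : F.IsHomogeneous m) (hF0 : F ≠ 0) (u v : σ → ℂ)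
    (h : ∀ α β : ℂ, eval (α • u + β • v) f = 0 → eval (α • u + β • v) F = 0 → α = 0 ∧ β = 0) :
    IsRelPrime f F := by
  intro q hqf hqF
  by_contra hu
  obtain ⟨e, he, hpos⟩ := exists_eval_smul_of_dvd hF hF0 hqF
  obtain ⟨α, β, hne, h0⟩ := exists_zero_on_line (hpos hu) he u v
  obtain ⟨a, rfl⟩ := hqf
  obtain ⟨b, rfl⟩ := hqF
  have := h α β (by simp [h0]) (by simp [h0])
  tauto

/-- The derivative in the direction of a vector. -/
def dirDeriv (v : σ → ℂ) : Derivation ℂ (MvPolynomial σ ℂ) (MvPolynomial σ ℂ) :=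
  mkDerivation ℂ fun i => C (v i)

theorem dirDeriv_eq_sum [Fintype σ] (v : σ → ℂ) (F : MvPolynomial σ ℂ) :
    dirDeriv v F = ∑ i, C (v i) * pderiv i F := by
  classical
  let f : Derivation ℂ (MvPolynomial σ ℂ) (MvPolynomial σ ℂ) →+
      (MvPolynomial σ ℂ → MvPolynomial σ ℂ) := Derivation.coeFnAddMonoidHom
  have hf : ∀ δ, f δ = δ := fun _ => rfl
  have : dirDeriv v = ∑ i, (C (v i) : MvPolynomial σ ℂ) • pderiv i := by
    refine MvPolynomial.derivation_ext fun j => ?_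
    rw [dirDeriv, mkDerivation_X, ← hf, map_sum, Finset.sum_apply]
    simp [hf, pderiv_X, Pi.single_apply]
  rw [this, ← hf, map_sum, Finset.sum_apply]
  simp [hf]

/-- A zero on the line of a repeated factor is a zero of `F` and of its derivative along the line.
-/
theorem squarefree_of_no_singular_zero_on_line {F : MvPolynomial σ ℂ} {m : ℕ}
    (hF : F.IsHomogeneous m) (u v : σ → ℂ)
    (h : ∀ α β : ℂ, eval (α • u + β • v) F = 0 → eval (α • u + β • v) (dirDeriv v F) = 0 →
      α = 0 ∧ β = 0) : Squarefree F := by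
  have hF0 : F ≠ 0 := by
    rintro rfl
    simpa using h 1 0
  intro q hq
  by_contra hu
  obtain ⟨e, he, hpos⟩ := exists_eval_smul_of_dvd hF hF0 (dvd_of_mul_right_dvd hq)
  obtain ⟨α, β, hne, h0⟩ := exists_zero_on_line (hpos hu) he u v
  obtain ⟨a, rfl⟩ := hq
  have := h α β (by simp [h0]) (by simp [Derivation.leibniz, h0])
  tauto

end Factors

/-! ### Linear coordinates -/

/-- Applied to a point `u` with `g u ≠ 0`; the examples for the generic conditions on `g` are built
from powers of the dual coordinates `L i`. -/
theorem exists_coordinates {n : ℕ} {u : Fin (n + 1) → ℂ} (hu : u ≠ 0) :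
    ∃ (B : Module.Basis (Fin (n + 1)) ℂ (Fin (n + 1) → ℂ)) (L : Fin (n + 1) → CoordRing n),
      B 0 = u ∧ (∀ i, (L i).IsHomogeneous 1) ∧ (∀ i x, eval x (L i) = B.repr x i) ∧
      ∀ i j, dirDeriv (B j) (L i) = if i = j then 1 else 0 := by
  have h1 : (Pi.single 0 1 : Fin (n + 1) → ℂ) ≠ 0 := by simp
  obtain ⟨A, hA⟩ := SeparatingDual.exists_continuousLinearEquiv_apply_eq (R := ℂ) h1 hu
  let B := (Pi.basisFun ℂ (Fin (n + 1))).map A.toLinearEquiv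
  let L : Fin (n + 1) → CoordRing n := fun i => ∑ j, C (B.repr (Pi.single j 1) i) * X j
  have hL : ∀ i x, eval x (L i) = B.repr x i := fun i x => by
    conv_rhs => rw [pi_eq_sum_univ' x]
    simp [L, map_sum, Finsupp.finsetSum_apply, mul_comm]
  refine ⟨B, L, by simp [B, hA], fun i => IsHomogeneous.sum _ _ _ fun j _ =>
    isHomogeneous_C_mul_X _ _, hL, fun i j => ?_⟩
  have h2 : dirDeriv (B j) (L i) = C (eval (B j) (L i)) := by
    simp [L, dirDeriv, Derivation.leibniz, mkDerivation_X, MvPolynomial.derivation_C]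
  rw [h2, hL, B.repr_self, Finsupp.single_apply]
  simp [eq_comm, apply_ite]

theorem exists_eval_ne_zero {σ : Type*} {F : MvPolynomial σ ℂ} (hF : F ≠ 0) : ∃ u, eval u F ≠ 0 := by
  by_contra! h
  exact hF (MvPolynomial.funext fun x => by simpa using h x)

/-! ### General pairs of forms -/

/-- Pairs of forms of degrees `k` and `e`. -/
abbrev FormPair (n k e : ℕ) : Type :=
  ↥(homogeneousSubmodule (Fin (n + 1)) ℂ k) × ↥(homogeneousSubmodule (Fin (n + 1)) ℂ e)

namespace FormPair

variable {n k e : ℕ}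

/-- The first form. -/
def fst (s : FormPair n k e) : CoordRing n := s.1

/-- The second form. -/
def snd (s : FormPair n k e) : CoordRing n := s.2

/-- The norm of `f₁ + y f₂`, where `y ^ 2 = g`. -/
def norm (g : CoordRing n) (s : FormPair n k e) : CoordRing n := s.fst ^ 2 - g * s.snd ^ 2

theorem fst_isHomogeneous (s : FormPair n k e) : s.fst.IsHomogeneous k := s.1.2

theorem snd_isHomogeneous (s : FormPair n k e) : s.snd.IsHomogeneous e := s.2.2

theorem norm_isHomogeneous {d : ℕ} {g : CoordRing n} (hg : g.IsHomogeneous (2 * d))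
    (hk : d + e = k) (s : FormPair n k e) : (s.norm g).IsHomogeneous (2 * k) := by
  have h1 := s.fst_isHomogeneous.pow 2
  have h2 := hg.mul (s.snd_isHomogeneous.pow 2)
  rw [show k * 2 = 2 * k by ring] at h1
  rw [show 2 * d + e * 2 = 2 * k by omega] at h2
  exact h1.sub h2

theorem isPolyFamily_fst : IsPolyFamily (fst (n := n) (k := k) (e := e)) :=
  IsPolyFamily.linear (E := FormPair n k e)
    ((homogeneousSubmodule (Fin (n + 1)) ℂ k).subtype ∘ₗ LinearMap.fst ℂ _ _)

theorem isPolyFamily_snd : IsPolyFamily (snd (n := n) (k := k) (e := e)) :=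
  IsPolyFamily.linear (E := FormPair n k e)
    ((homogeneousSubmodule (Fin (n + 1)) ℂ e).subtype ∘ₗ LinearMap.snd ℂ _ _)

theorem isPolyFamily_norm (g : CoordRing n) :
    IsPolyFamily (norm (n := n) (k := k) (e := e) g) :=
  (isPolyFamily_fst.pow 2).sub ((IsPolyFamily.const g).mul (isPolyFamily_snd.pow 2))

end FormPair

theorem isHomogeneous_dirDeriv {n m : ℕ} {F : CoordRing n} (hF : F.IsHomogeneous m)
    (v : Fin (n + 1) → ℂ) : (dirDeriv v F).IsHomogeneous (m - 1) := by
  rw [dirDeriv_eq_sum]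
  exact IsHomogeneous.sum _ _ _ fun i _ => (hF.pderiv).C_mul _

theorem IsPolyFamily.dirDeriv {E : Type*} [AddCommGroup E] [Module ℂ E] {n : ℕ}
    {h : E → CoordRing n} (hh : IsPolyFamily h) (v : Fin (n + 1) → ℂ) :
    IsPolyFamily fun s => DoubleCover.dirDeriv v (h s) := by
  simp only [dirDeriv_eq_sum]
  exact IsPolyFamily.sum _ fun i _ => (IsPolyFamily.const _).mul (hh.pderiv i)

/-! ### Coprimality and squarefreeness, tested on a line -/

section Line

variable {n d k e : ℕ} {g : CoordRing (n + 1)}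

/-- The linear forms that cut out the line through the first two coordinate points. -/
def lineForm (L : Fin (n + 2) → CoordRing (n + 1)) (i : Fin (n + 2)) : CoordRing (n + 1) :=
  -- The zero form imposes no condition; it only keeps the index set uniform.
  if i = 0 ∨ i = 1 then 0 else L i

theorem lineForm_isHomogeneous {L : Fin (n + 2) → CoordRing (n + 1)}
    (hL : ∀ i, (L i).IsHomogeneous 1) (i : Fin (n + 2)) : (lineForm L i).IsHomogeneous 1 := by
  unfold lineForm
  split_ifs
  exacts [isHomogeneous_zero _ _ _, hL i]

variable {B : Module.Basis (Fin (n + 2)) ℂ (Fin (n + 2) → ℂ)} {L : Fin (n + 2) → CoordRing (n + 1)}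

theorem eq_line_point (hL : ∀ i x, eval x (L i) = B.repr x i) {x : Fin (n + 2) → ℂ}
    (hx : ∀ i, eval x (lineForm L i) = 0) :
    x = eval x (L 0) • B 0 + eval x (L 1) • B 1 := by
  conv_lhs => rw [← B.sum_repr x]
  rw [Fin.sum_univ_succ, Fin.sum_univ_succ, Finset.sum_eq_zero, add_zero, hL, hL]
  · rfl
  · intro i _
    have h1 : ¬ (i.succ.succ = 0 ∨ i.succ.succ = 1) := by
      rw [Fin.ext_iff, Fin.ext_iff]
      simp
    have := hx i.succ.succ
    rw [lineForm, if_neg h1, hL] at this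
    rw [this, zero_smul]

theorem eval_lineForm_of_line (hL : ∀ i x, eval x (L i) = B.repr x i) (α β : ℂ)
    (i : Fin (n + 2)) : eval (α • B 0 + β • B 1) (lineForm L i) = 0 := by
  unfold lineForm
  split_ifs with h
  · simp
  · push Not at h
    rw [hL]
    simp [h.1.symm, h.2.symm]

theorem line_coordinates_eq_zero {α β : ℂ} (h : α • B 0 + β • B 1 = 0) : α = 0 ∧ β = 0 := by
  have h0 := congrArg (fun x => B.repr x 0) h
  have h1 := congrArg (fun x => B.repr x 1) h
  simp at h0 h1
  exact ⟨h0, h1⟩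

/-- A number avoiding finitely many values, as needed for a squarefree norm on a line. -/
theorem exists_good_scalar {Q γ : Polynomial ℂ} (hQ : Q ≠ 0) (hγ : γ.eval 0 ≠ 0) (c₀ : ℂ) (N : ℕ)
    (hN : N ≠ 0) :
    ∃ c : ℂ, c ≠ 0 ∧ c ^ 2 * c₀ ≠ 1 ∧ ∀ t, Q.eval t = 0 → t ^ N ≠ c ^ 2 * γ.eval t := by
  let R : Polynomial ℂ := Polynomial.X * (Polynomial.C c₀ * Polynomial.X ^ 2 - 1) *
    ∏ t ∈ Q.roots.toFinset, (Polynomial.C (γ.eval t) * Polynomial.X ^ 2 - Polynomial.C (t ^ N))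
  have hR : R ≠ 0 := by
    refine mul_ne_zero (mul_ne_zero Polynomial.X_ne_zero fun h => ?_)
      (Finset.prod_ne_zero_iff.2 fun t _ h => ?_)
    · simpa using congrArg (Polynomial.eval 0) h
    -- A vanishing factor would force `t = 0` by its constant term, and then `γ 0 = 0`.
    · have h0 : t ^ N = 0 := by simpa using congrArg (Polynomial.eval 0) h
      have h1 := congrArg (Polynomial.eval 1) h
      rw [eq_zero_of_pow_eq_zero h0] at h1
      refine hγ ?_
      simpa [hN] using h1
  obtain ⟨c, hc⟩ : ∃ c, R.eval c ≠ 0 := by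
    by_contra! h
    exact hR (Polynomial.funext fun z => by simpa using h z)
  simp only [R, Polynomial.eval_mul, mul_ne_zero_iff, Polynomial.eval_prod,
    Finset.prod_ne_zero_iff] at hc
  obtain ⟨⟨h1, h2⟩, h3⟩ := hc
  refine ⟨c, by simpa using h1, fun h => h2 ?_, fun t ht h => h3 t ?_ ?_⟩
  · simp [mul_comm c₀, h]
  · simpa [hQ] using ht
  · rw [Polynomial.eval_sub, Polynomial.eval_mul, Polynomial.eval_C, Polynomial.eval_pow,
      Polynomial.eval_X, Polynomial.eval_C, h]
    ring

/-- Example: `f₁ = L 1 ^ k`, whose only zero on the line through `B 0 = u` and `B 1` is `u`, where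
`g ≠ 0`. -/
theorem generic_isRelPrime (hg : g.IsHomogeneous (2 * d)) (hg0 : g ≠ 0) (hd : 0 < d) :
    Generic fun s : FormPair (n + 1) k e => IsRelPrime s.fst g := by
  obtain ⟨u, hu⟩ := exists_eval_ne_zero hg0
  have hu0 : u ≠ 0 := by
    rintro rfl
    have := eval_smul_of_isHomogeneous hg 0 0
    rw [zero_smul, zero_pow (by omega), zero_mul] at this
    exact hu this
  obtain ⟨B, L, hB, hLh, hL, -⟩ := exists_coordinates hu0
  let s₀ : FormPair (n + 1) k e := ⟨⟨L 1 ^ k, by simpa using (hLh 1).pow k⟩, 0⟩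
  let h : (Fin 2 ⊕ Fin (n + 2)) → FormPair (n + 1) k e → CoordRing (n + 1) :=
    Sum.elim ![FormPair.fst, fun _ => g] fun i _ => lineForm L i
  have key := generic_of_no_common_zero (h := h) (D := Sum.elim ![k, 2 * d] fun _ => 1)
    ?_ ?_ s₀ ?_
  · refine key.mono fun s hs => isRelPrime_of_no_common_zero_on_line hg hg0 (B 0) (B 1)
      fun α β h1 h2 => line_coordinates_eq_zero (B := B) (hs _ ?_)
    rintro (i | i)
    · fin_cases i
      exacts [h1, h2]
    · exact eval_lineForm_of_line hL α β i
  · rintro (i | i) s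
    · fin_cases i
      exacts [s.fst_isHomogeneous, hg]
    · exact lineForm_isHomogeneous hLh i
  · rintro (i | i)
    · fin_cases i
      exacts [FormPair.isPolyFamily_fst, IsPolyFamily.const _]
    · exact IsPolyFamily.const _
  · intro x hx
    have hx1 := eq_line_point hL fun i => hx (Sum.inr i)
    have h1 : eval x (L 1 ^ k) = 0 := hx (Sum.inl 0)
    have h2 : eval x g = 0 := hx (Sum.inl 1)
    rw [map_pow] at h1
    rw [eq_zero_of_pow_eq_zero h1, zero_smul, add_zero, hB] at hx1
    rw [hx1, eval_smul_of_isHomogeneous hg] at h2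
    rw [hx1, eq_zero_of_pow_eq_zero ((mul_eq_zero.1 h2).resolve_right hu), zero_smul]

theorem generic_squarefree (hg : g.IsHomogeneous (2 * d)) (hg0 : g ≠ 0) (hd : 0 < d)
    (hk : d + e = k) :
    Generic fun s : FormPair (n + 1) k e => Squarefree (s.norm g) := by
  obtain ⟨u, hu⟩ := exists_eval_ne_zero hg0
  have hu0 : u ≠ 0 := by
    rintro rfl
    have := eval_smul_of_isHomogeneous hg 0 0
    rw [zero_smul, zero_pow (by omega), zero_mul] at this
    exact hu this
  obtain ⟨B, L, hB, hLh, hL, hLd⟩ := exists_coordinates hu0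
  have hL0 : ∀ α β : ℂ, eval (α • B 0 + β • B 1) (L 0) = α := fun α β => by
    rw [hL]
    simp
  have hL1 : ∀ α β : ℂ, eval (α • B 0 + β • B 1) (L 1) = β := fun α β => by
    rw [hL]
    simp
  -- The example is `f₁ = L 1 ^ k`, `f₂ = c L 0 ^ e`. At `B 0 + t • B 1` a singular zero satisfies
  -- `t ^ (2k) = c² γ(t)` and `2k t ^ (2k-1) = c² γ'(t)`. Eliminating `c` gives `t γ' - 2k γ = 0`,
  -- the equation `Q`, which has finitely many roots as `Q(0) = -2k g(u) ≠ 0`; then `c` is chosen to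
  -- violate the first equation at each of them.
  let q : CoordRing (n + 1) := L 1 * dirDeriv (B 1) g - C (2 * k : ℂ) * g
  have hq : q.IsHomogeneous (2 * d) := by
    have h1 := (hLh 1).mul (isHomogeneous_dirDeriv hg (B 1))
    rw [show 1 + (2 * d - 1) = 2 * d by omega] at h1
    exact h1.sub (hg.C_mul _)
  obtain ⟨Q, hQ⟩ := exists_polynomial_eval_line q (B 0) (B 1)
  obtain ⟨γ, hγ⟩ := exists_polynomial_eval_line g (B 0) (B 1)
  have hγ0 : γ.eval 0 ≠ 0 := by
    rw [hγ, zero_smul, add_zero, hB]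
    exact hu
  have hQ0 : Q ≠ 0 := by
    rintro rfl
    have h1 := hQ 0
    have h2 := hL1 1 0
    simp only [one_smul, zero_smul, add_zero, hB] at h2
    rw [zero_smul, add_zero, Polynomial.eval_zero] at h1
    simp only [q, map_sub, map_mul, eval_C, hB, h2, zero_mul, zero_sub] at h1
    have h3 : (2 * k : ℂ) * eval u g ≠ 0 :=
      mul_ne_zero (mul_ne_zero two_ne_zero (Nat.cast_ne_zero.2 (by omega))) hu
    exact h3 (neg_eq_zero.1 h1.symm)
  obtain ⟨c, hc0, hc1, hc⟩ := exists_good_scalar hQ0 hγ0 (eval (B 1) g) (2 * k) (by omega)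
  let s₀ : FormPair (n + 1) k e := ⟨⟨L 1 ^ k, by simpa using (hLh 1).pow k⟩,
    ⟨C c * L 0 ^ e, by simpa using ((hLh 0).pow e).C_mul c⟩⟩
  have hs₀ : s₀.norm g = (L 1 ^ k) ^ 2 - g * (C c * L 0 ^ e) ^ 2 := rfl
  let h : (Fin 2 ⊕ Fin (n + 2)) → FormPair (n + 1) k e → CoordRing (n + 1) :=
    Sum.elim ![FormPair.norm g, fun s => dirDeriv (B 1) (s.norm g)] fun i _ => lineForm L i
  have key := generic_of_no_common_zero (h := h) (D := Sum.elim ![2 * k, 2 * k - 1] fun _ => 1)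
    ?_ ?_ s₀ ?_
  · refine key.mono fun s hs => squarefree_of_no_singular_zero_on_line
      (s.norm_isHomogeneous hg hk) (B 0) (B 1) fun α β h1 h2 => line_coordinates_eq_zero (B := B) (hs _ ?_)
    rintro (i | i)
    · fin_cases i
      exacts [h1, h2]
    · exact eval_lineForm_of_line hL α β i
  · rintro (i | i) s
    · fin_cases i
      exacts [s.norm_isHomogeneous hg hk, isHomogeneous_dirDeriv (s.norm_isHomogeneous hg hk) _]
    · exact lineForm_isHomogeneous hLh i
  · rintro (i | i)
    · fin_cases i
      exacts [FormPair.isPolyFamily_norm g, (FormPair.isPolyFamily_norm g).dirDeriv _]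
    · exact IsPolyFamily.const _
  · intro x hx
    have hx1 := eq_line_point hL fun i => hx (Sum.inr i)
    set α := eval x (L 0)
    set β := eval x (L 1)
    have hF : β ^ (2 * k) = c ^ 2 * α ^ (2 * e) * eval x g := by
      have h1 : eval x (s₀.norm g) = 0 := hx (Sum.inl 0)
      rw [hs₀] at h1
      simp only [map_sub, map_mul, map_pow, eval_C] at h1
      linear_combination h1
    have hdF : 2 * k * β ^ (2 * k - 1) = c ^ 2 * α ^ (2 * e) * eval x (dirDeriv (B 1) g) := by
      have h1 : eval x (dirDeriv (B 1) (s₀.norm g)) = 0 := hx (Sum.inl 1)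
      have h2 : s₀.norm g = L 1 ^ (2 * k) - g * (C (c ^ 2) * L 0 ^ (2 * e)) := by
        rw [hs₀, C_pow]
        ring
      have h3 : dirDeriv (B 1) (C (c ^ 2)) = 0 := MvPolynomial.derivation_C _ _
      rw [h2] at h1
      simp only [map_sub, Derivation.leibniz, Derivation.leibniz_pow, hLd, h3] at h1
      simp [smul_eq_mul] at h1
      linear_combination h1
    -- The point `B 1` at infinity of the line: for `e = 0` it is excluded by `c² g(B 1) ≠ 1`, for
    -- `e > 0` by `F = β ^ (2k)` there.
    by_cases hα : α = 0
    · have hβ : β = 0 := by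
        rw [hα, zero_smul, zero_add] at hx1
        rw [hα, hx1, eval_smul_of_isHomogeneous hg] at hF
        rcases Nat.eq_zero_or_pos e with rfl | he
        · obtain rfl : d = k := by omega
          have h1 : β ^ (2 * d) * (1 - c ^ 2 * eval (B 1) g) = 0 := by
            simp only [mul_zero, pow_zero] at hF
            linear_combination hF
          exact eq_zero_of_pow_eq_zero
            ((mul_eq_zero.1 h1).resolve_right (sub_ne_zero.2 hc1.symm))
        · rw [zero_pow (by omega), mul_zero, zero_mul] at hF
          exact eq_zero_of_pow_eq_zero hF
      rw [hx1, hα, hβ, zero_smul, zero_smul, add_zero]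
    · exfalso
      have hx2 : x = α • (B 0 + (β / α) • B 1) := by
        rw [smul_add, smul_smul, mul_div_cancel₀ _ hα]
        exact hx1
      have hqx : eval x q = 0 := by
        have h1 : c ^ 2 * α ^ (2 * e) * eval x q = 0 := by
          simp only [q, map_sub, map_mul, eval_C]
          have h2 : β ^ (2 * k) = β * β ^ (2 * k - 1) := by
            rw [← pow_succ']
            congr 1
            omega
          linear_combination (-β) * hdF + 2 * k * hF - 2 * k * h2
        exact (mul_eq_zero.1 h1).resolve_left
          (mul_ne_zero (pow_ne_zero _ hc0) (pow_ne_zero _ hα))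
      have hQt : Q.eval (β / α) = 0 := by
        rw [hx2, eval_smul_of_isHomogeneous hq] at hqx
        rw [hQ]
        exact (mul_eq_zero.1 hqx).resolve_left (pow_ne_zero _ hα)
      refine hc _ hQt ?_
      have h1 : eval x g = α ^ (2 * d) * γ.eval (β / α) := by
        rw [hγ, ← eval_smul_of_isHomogeneous hg, ← hx2]
      rw [h1] at hF
      rw [div_pow, div_eq_iff (pow_ne_zero _ hα), hF, show 2 * k = 2 * d + 2 * e by omega, pow_add]
      ring

end Line

/-- Together with `g` and the coordinates `L i` for `i > 2`, the pair `f₁, f₂` gives as many forms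
as variables. For `f₁ = L 1 ^ k`, `f₂ = L 2 ^ e` a common zero is a multiple of `u`, hence zero
since `g u ≠ 0`. -/
theorem generic_no_component {n d k e : ℕ} {g : CoordRing (n + 2)} (hg : g.IsHomogeneous (2 * d))
    (hg0 : g ≠ 0) (hd : 0 < d) (hk : 0 < k) (he : 0 < e) :
    Generic fun s : FormPair (n + 2) k e => ∀ h : CoordRing (n + 2),
      (∀ x, eval x s.fst = 0 → eval x s.snd = 0 → eval x (h * g) = 0) →
        ∀ x, eval x s.fst = 0 → eval x s.snd = 0 → eval x h = 0 := by
  obtain ⟨u, hu⟩ := exists_eval_ne_zero hg0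
  have hu0 : u ≠ 0 := by
    rintro rfl
    have := eval_smul_of_isHomogeneous hg 0 0
    rw [zero_smul, zero_pow (by omega), zero_mul] at this
    exact hu this
  obtain ⟨B, L, hB, hLh, hL, -⟩ := exists_coordinates hu0
  let s₀ : FormPair (n + 2) k e := ⟨⟨L 1 ^ k, by simpa using (hLh 1).pow k⟩,
    ⟨L 2 ^ e, by simpa using (hLh 2).pow e⟩⟩
  let h : Fin (n + 3) → FormPair (n + 2) k e → CoordRing (n + 2) := fun i s =>
    if i = 0 then g else if i = 1 then s.fst else if i = 2 then s.snd else L i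
  let D : Fin (n + 3) → ℕ := fun i =>
    if i = 0 then 2 * d else if i = 1 then k else if i = 2 then e else 1
  have hhD : ∀ i s, (h i s).IsHomogeneous (D i) := fun i s => by
    simp only [h, D]
    split_ifs
    exacts [hg, s.fst_isHomogeneous, s.snd_isHomogeneous, hLh i]
  have h20 : (2 : Fin (n + 3)) ≠ 0 := by
    rw [Ne, Fin.ext_iff, Fin.val_two]
    simp
  have h21 : (2 : Fin (n + 3)) ≠ 1 := by
    rw [Ne, Fin.ext_iff, Fin.val_two]
    simp
  have e0 : ∀ s, h 0 s = g := fun s => by simp [h]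
  have e1 : ∀ s, h 1 s = s.fst := fun s => by simp [h]
  have e2 : ∀ s, h 2 s = s.snd := fun s => by simp [h, h20, h21]
  have key := generic_of_no_common_zero (h := h) hhD ?_ s₀ ?_
  · refine key.mono fun s hs p hp x hx1 hx2 => ?_
    refine vanishes_of_mul_vanishes (a := 1) (b := 2) (c := 0) rfl (fun i => hhD i s) (fun i => ?_)
      hs (by simp) h20.symm (h := p) (fun x h1 h2 => ?_) x (by rwa [e1]) (by rwa [e2])
    · simp only [D]
      split_ifs <;> omega
    · rw [e1] at h1
      rw [e2] at h2
      rw [e0]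
      exact hp x h1 h2
  · intro i
    simp only [h]
    split_ifs
    exacts [IsPolyFamily.const _, FormPair.isPolyFamily_fst, FormPair.isPolyFamily_snd,
      IsPolyFamily.const _]
  · intro x hx
    have hz : ∀ i, i ≠ 0 → eval x (L i) = 0 := fun i hi => by
      have := hx i
      by_cases hi1 : i = 1
      · subst hi1
        have h1 : eval x (L 1 ^ k) = 0 := by rwa [e1] at this
        rw [map_pow] at h1
        exact eq_zero_of_pow_eq_zero h1
      by_cases hi2 : i = 2
      · subst hi2
        have h1 : eval x (L 2 ^ e) = 0 := by rwa [e2] at this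
        rw [map_pow] at h1
        exact eq_zero_of_pow_eq_zero h1
      simpa [h, hi, hi1, hi2] using this
    have hx1 : x = eval x (L 0) • u := by
      conv_lhs => rw [← B.sum_repr x]
      rw [Finset.sum_eq_single 0 (fun i _ hi => by rw [← hL, hz i hi, zero_smul]) (by simp), hB, hL]
    have h2 : eval x g = 0 := by simpa only [e0] using hx 0
    rw [hx1, eval_smul_of_isHomogeneous hg] at h2
    rw [hx1, eq_zero_of_pow_eq_zero ((mul_eq_zero.1 h2).resolve_right hu), zero_smul]

/-! ### Smooth complete intersections -/

theorem geom_sum_lt_pow {T : ℝ} (hT : 2 ≤ T) (N : ℕ) : ∑ i ∈ Finset.range N, T ^ i < T ^ N := by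
  induction N with
  | zero => simp
  | succ N ih =>
    rw [Finset.sum_range_succ, pow_succ]
    nlinarith [pow_pos (by linarith : 0 < T) N]

/-- The vanishing minors make `‖x i‖` proportional to `3 ^ i` on the nonzero coordinates. The terms
of the sum then have absolute values proportional to `3 ^ (i (d + e))`, so the last nonzero one
outweighs all the others together. -/
theorem eq_zero_of_fermat {N d e : ℕ} (hd : 0 < d) (he : 0 < e) {x : Fin N → ℂ}
    (h : ∀ i j, x i ^ (d + e - 1) * (3 ^ (j.1 * d) * x j ^ (e - 1)) =
      x j ^ (d + e - 1) * (3 ^ (i.1 * d) * x i ^ (e - 1)))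
    (h0 : ∑ i, 3 ^ (i.1 * d) * x i ^ e = 0) : x = 0 := by
  classical
  by_contra hx
  obtain ⟨i₀, hi₀⟩ := Function.ne_iff.1 hx
  obtain ⟨M, hM, hmax⟩ := Finset.exists_max_image (Finset.univ.filter fun i => x i ≠ 0) id
    ⟨i₀, by simpa using hi₀⟩
  simp only [Finset.mem_filter, Finset.mem_univ, true_and, id] at hM hmax
  have hnorm : ∀ i, x i ≠ 0 → ‖x i‖ * 3 ^ M.1 = ‖x M‖ * 3 ^ i.1 := fun i hi => by
    have h1 := h i M
    have h2 : x i ^ d * 3 ^ (M.1 * d) = x M ^ d * 3 ^ (i.1 * d) := by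
      have h3 : x i ^ (e - 1) * x M ^ (e - 1) ≠ 0 :=
        mul_ne_zero (pow_ne_zero _ hi) (pow_ne_zero _ hM)
      refine mul_left_cancel₀ h3 ?_
      rw [show d + e - 1 = d + (e - 1) by omega, pow_add, pow_add] at h1
      linear_combination h1
    have h4 := congrArg norm h2
    simp only [norm_mul, norm_pow, RCLike.norm_ofNat, pow_mul] at h4
    rw [← mul_pow, ← mul_pow] at h4
    exact (pow_left_inj₀ (by positivity) (by positivity) hd.ne').1 h4
  have hterm : ∀ i, x i ≠ 0 →
      ‖3 ^ (i.1 * d) * x i ^ e‖ * (3 ^ M.1) ^ e = ‖x M‖ ^ e * (3 ^ (d + e)) ^ i.1 := fun i hi => by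
    simp only [norm_mul, norm_pow, RCLike.norm_ofNat]
    rw [mul_assoc, ← mul_pow, hnorm i hi, mul_pow, ← pow_mul, ← pow_mul, mul_comm (d + e),
      mul_add, pow_add]
    ring
  have hT : (2 : ℝ) ≤ 3 ^ (d + e) := by
    calc (2 : ℝ) ≤ 3 ^ 1 := by norm_num
      _ ≤ 3 ^ (d + e) := pow_le_pow_right₀ (by norm_num) (by omega)
  have hsum : 3 ^ (M.1 * d) * x M ^ e = - ∑ i ∈ Finset.univ.erase M, 3 ^ (i.1 * d) * x i ^ e := by
    rw [eq_neg_iff_add_eq_zero, Finset.add_sum_erase _ (fun i : Fin N => 3 ^ (i.1 * d) * x i ^ e)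
      (Finset.mem_univ M)]
    exact h0
  have hle : ‖x M‖ ^ e * (3 ^ (d + e)) ^ M.1 ≤
      ‖x M‖ ^ e * ∑ i ∈ Finset.range M.1, (3 ^ (d + e)) ^ i := by
    rw [← hterm M hM, hsum, norm_neg]
    calc _ ≤ (∑ i ∈ Finset.univ.erase M, ‖3 ^ (i.1 * d) * x i ^ e‖) * (3 ^ M.1) ^ e := by
          gcongr
          exact norm_sum_le _ _
      _ ≤ ∑ i ∈ Finset.univ.filter (fun i : Fin N => i < M), ‖x M‖ ^ e * (3 ^ (d + e)) ^ i.1 := by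
          rw [Finset.sum_mul]
          rw [← Finset.sum_subset (s₁ := (Finset.univ.erase M).filter fun i => x i ≠ 0)
            (Finset.filter_subset _ _)]
          · refine (Finset.sum_congr rfl fun i hi => hterm i (Finset.mem_filter.1 hi).2).trans_le ?_
            refine Finset.sum_le_sum_of_subset_of_nonneg (fun i hi => ?_) fun i _ _ => by positivity
            simp only [Finset.mem_filter, Finset.mem_erase, Finset.mem_univ, and_true,
              true_and] at hi ⊢
            exact lt_of_le_of_ne (hmax i hi.2) hi.1
          · intro i h1 h2
            have : x i = 0 := by
              by_contra h3
              exact h2 (Finset.mem_filter.2 ⟨h1, h3⟩)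
            simp [this, he.ne']
      _ = _ := by
          rw [Finset.mul_sum]
          refine Finset.sum_nbij (fun i => i.1) (fun i hi => ?_) (fun i _ j _ hij => Fin.ext hij)
            (fun i hi => ?_) fun i _ => rfl
          · simpa using hi
          · have hi : i < M.1 := by simpa using hi
            exact ⟨⟨i, hi.trans M.2⟩, by simpa using Fin.mk_lt_of_lt_val hi, rfl⟩
  have := (mul_le_mul_iff_right₀ (by positivity : 0 < ‖x M‖ ^ e)).1 hle
  exact absurd (geom_sum_lt_pow hT M.1) (not_lt.2 this)

/-- The two forms and the minors of their Jacobian are a polynomial family. The weights `3 ^ (i d)`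
in the example give the growth used in `eq_zero_of_fermat`. -/
theorem generic_smooth {n d k e : ℕ} (hd : 0 < d) (he : 0 < e) (hk : d + e = k) :
    Generic fun s : FormPair n k e => ∀ x, eval x s.fst = 0 → eval x s.snd = 0 →
      (∀ i j, eval x (pderiv i s.fst) * eval x (pderiv j s.snd) =
        eval x (pderiv j s.fst) * eval x (pderiv i s.snd)) → x = 0 := by
  subst hk
  let f₁ : CoordRing n := ∑ i, X i ^ (d + e)
  let f₂ : CoordRing n := ∑ i : Fin (n + 1), C (3 ^ (i.1 * d)) * X i ^ e
  have hf₁ : f₁.IsHomogeneous (d + e) :=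
    IsHomogeneous.sum _ _ _ fun i _ => isHomogeneous_X_pow _ _
  have hf₂ : f₂.IsHomogeneous e :=
    IsHomogeneous.sum _ _ _ fun i _ => isHomogeneous_C_mul_X_pow _ _ _
  let s₀ : FormPair n (d + e) e := ⟨⟨f₁, hf₁⟩, ⟨f₂, hf₂⟩⟩
  have h1 : s₀.fst = f₁ := rfl
  have h2 : s₀.snd = f₂ := rfl
  let h : (Fin 2 ⊕ (Fin (n + 1) × Fin (n + 1))) → FormPair n (d + e) e → CoordRing n :=
    Sum.elim ![FormPair.fst, FormPair.snd] fun p s =>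
      pderiv p.1 s.fst * pderiv p.2 s.snd - pderiv p.2 s.fst * pderiv p.1 s.snd
  have key := generic_of_no_common_zero (h := h)
    (D := Sum.elim ![d + e, e] fun _ => d + e - 1 + (e - 1)) ?_ ?_ s₀ ?_
  · refine key.mono fun s hs x hx1 hx2 hx3 => hs x ?_
    rintro (i | p)
    · fin_cases i
      exacts [hx1, hx2]
    · simp [h, hx3 p.1 p.2]
  · rintro (i | p) s
    · fin_cases i
      exacts [s.fst_isHomogeneous, s.snd_isHomogeneous]
    · exact (s.fst_isHomogeneous.pderiv.mul s.snd_isHomogeneous.pderiv).sub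
        (s.fst_isHomogeneous.pderiv.mul s.snd_isHomogeneous.pderiv)
  · rintro (i | p)
    · fin_cases i
      exacts [FormPair.isPolyFamily_fst, FormPair.isPolyFamily_snd]
    · exact ((FormPair.isPolyFamily_fst.pderiv _).mul (FormPair.isPolyFamily_snd.pderiv _)).sub
        ((FormPair.isPolyFamily_fst.pderiv _).mul (FormPair.isPolyFamily_snd.pderiv _))
  · intro x hx
    have hd₁ : ∀ i, eval x (pderiv i f₁) = (d + e : ℕ) * x i ^ (d + e - 1) := fun i => by
      simp only [f₁, map_sum, Derivation.leibniz_pow, pderiv_X]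
      rw [Finset.sum_eq_single i (fun j _ hj => by simp [hj.symm]) (by simp)]
      simp
    have hd₂ : ∀ i : Fin (n + 1),
        eval x (pderiv i f₂) = e * (3 ^ (i.1 * d) * x i ^ (e - 1)) := fun i => by
      simp only [f₂, map_sum, Derivation.leibniz, Derivation.leibniz_pow, pderiv_X, pderiv_C]
      rw [Finset.sum_eq_single i (fun j _ hj => by simp [hj.symm]) (by simp)]
      simp
      ring
    refine eq_zero_of_fermat hd he (fun i j => ?_) ?_
    · have := hx (Sum.inr (i, j))
      simp only [h, Sum.elim_inr, h1, h2, map_sub, map_mul, hd₁, hd₂] at this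
      have hne : ((d + e : ℕ) : ℂ) * e ≠ 0 :=
        mul_ne_zero (Nat.cast_ne_zero.2 (by omega)) (Nat.cast_ne_zero.2 he.ne')
      refine mul_left_cancel₀ hne ?_
      linear_combination this
    · have : eval x f₂ = 0 := hx (Sum.inl 1)
      simpa [f₂] using this

variable {n d k e : ℕ}

/-! ### Divisibility by squarefree forms -/

theorem isRelPrime_X_X {σ : Type*} {i j : σ} (hij : i ≠ j) :
    IsRelPrime (X i : MvPolynomial σ ℂ) (X j) := by
  have hi : Prime (X i : MvPolynomial σ ℂ) := MvPolynomial.X_prime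
  refine (hi.irreducible.isRelPrime_iff_not_dvd).2 fun h => ?_
  obtain ⟨c, hc⟩ := h
  classical
  have := congrArg (eval (Pi.single j (1 : ℂ))) hc
  simp [hij] at this

/-- A polynomial that vanishes at all nonzero zeros of a squarefree form is divisible by it. -/
theorem dvd_of_vanishes (hn : 1 ≤ n) {F C : CoordRing n} (hF : Squarefree F)
    (h : ∀ x, x ≠ 0 → eval x F = 0 → eval x C = 0) : F ∣ C := by
  -- Multiplying by a variable supplies the vanishing at the origin. Two coprime variables,
  -- available as `n ≥ 1`, then allow the extra factor to be removed.
  have hX : ∀ i, F ∣ X i * C := fun i => by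
    have h1 : X i * C ∈ (Ideal.span {F}).radical := by
      rw [← vanishingIdeal_zeroLocus_eq_radical (K := ℂ), mem_vanishingIdeal_iff]
      intro x hx
      have hx : eval x F = 0 := by simpa [zeroLocus_span, aeval_eq_eval] using hx
      by_cases hx0 : x = 0
      · simp [hx0]
      · simp [aeval_eq_eval, h x hx0 hx]
    obtain ⟨N, hN⟩ := h1
    rw [Ideal.mem_span_singleton] at hN
    exact hF.isRadical N _ hN
  obtain ⟨a, b, ha, hb, rfl⟩ := exists_dvd_and_dvd_of_dvd_mul (hX 0)
  have hij : (0 : Fin (n + 1)) ≠ Fin.last n := by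
    rw [Ne, Fin.ext_iff]
    simp
    omega
  have h1 : IsRelPrime a (X (Fin.last n)) := (isRelPrime_X_X hij).of_dvd_left ha
  have h2 : a ∣ C := h1.dvd_of_dvd_mul_left ((dvd_mul_right a b).trans (hX _))
  exact (squarefree_mul_iff.1 hF).1.mul_dvd h2 hb

theorem not_isUnit_of_isHomogeneous {F : CoordRing n} {m : ℕ} (hF : F.IsHomogeneous m)
    (hm : 0 < m) : ¬ IsUnit F := fun h => by
  have h1 := eval_smul_of_isHomogeneous hF 0 0
  rw [zero_smul, zero_pow hm.ne', zero_mul] at h1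
  have := h.map (eval (0 : Fin (n + 1) → ℂ))
  rw [h1] at this
  exact not_isUnit_zero this

/-! ### The norm and the section `f₁ + y f₂` -/

namespace FormPair

variable {g : CoordRing n} (s : FormPair n k e)

theorem isRelPrime_fst_snd (hF : Squarefree (s.norm g)) : IsRelPrime s.fst s.snd := by
  intro h h1 h2
  refine hF h ?_
  obtain ⟨a, ha⟩ := h1
  obtain ⟨b, hb⟩ := h2
  exact ⟨a ^ 2 - g * b ^ 2, by rw [norm, ha, hb]; ring⟩

theorem isRelPrime_norm_snd (hF : Squarefree (s.norm g)) : IsRelPrime (s.norm g) s.snd := by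
  intro h h1 h2
  have h3 : h ∣ s.fst ^ 2 := by
    have : s.fst ^ 2 = s.norm g + s.snd * (g * s.snd) := by rw [norm]; ring
    rw [this]
    exact dvd_add h1 (h2.mul_right _)
  exact (s.isRelPrime_fst_snd hF).pow_left h3 h2

theorem isRelPrime_norm (hg : IsRelPrime s.fst g) : IsRelPrime (s.norm g) g := by
  intro h h1 h2
  have h3 : h ∣ s.fst ^ 2 := by
    have : s.fst ^ 2 = s.norm g + g * s.snd ^ 2 := by rw [norm]; ring
    rw [this]
    exact dvd_add h1 (h2.mul_right _)
  exact hg.pow_left h3 h2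

/-- The section `f₁ + y f₂`. -/
def lift : WCoordRing n := rename some s.fst + X none * rename some s.snd

theorem lift_add (s t : FormPair n k e) : (s + t).lift = s.lift + t.lift := by
  simp only [lift, fst, snd, Prod.fst_add, Prod.snd_add, Submodule.coe_add, map_add]
  ring

theorem lift_smul (c : ℂ) (s : FormPair n k e) : (c • s).lift = c • s.lift := by
  simp only [lift, fst, snd, Prod.smul_fst, Prod.smul_snd, Submodule.coe_smul, map_smul, smul_add,
    mul_smul_comm]

theorem eval_lift (v : Option (Fin (n + 1)) → ℂ) :
    eval v s.lift = eval (v ∘ some) s.fst + v none * eval (v ∘ some) s.snd := by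
  simp [lift, eval_rename]

/-- Where `f₂ ≠ 0` the only choice is `y = -f₁ / f₂`; where `f₂ = 0` also `f₁ = 0`, and any square
root of `g` serves. -/
theorem exists_lift_eq_zero {x : Fin (n + 1) → ℂ} (hx : eval x (s.norm g) = 0) :
    ∃ y : ℂ, y ^ 2 = eval x g ∧ eval x s.fst + y * eval x s.snd = 0 := by
  rw [norm, map_sub, map_mul, map_pow, map_pow, sub_eq_zero] at hx
  by_cases h2 : eval x s.snd = 0
  · obtain ⟨y, hy⟩ := IsAlgClosed.exists_pow_nat_eq (eval x g) zero_lt_two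
    refine ⟨y, hy, ?_⟩
    rw [h2, zero_pow two_ne_zero, mul_zero] at hx
    rw [h2, mul_zero, add_zero]
    exact eq_zero_of_pow_eq_zero hx
  · refine ⟨- eval x s.fst / eval x s.snd, ?_, ?_⟩
    · rw [div_pow, neg_sq, hx]
      field_simp
    · field_simp
      ring

theorem lift_isWeightedHomogeneous (hk : d + e = k) :
    s.lift.IsWeightedHomogeneous (weight n d) k := by
  have key : ∀ {F : CoordRing n} {m : ℕ}, F.IsHomogeneous m →
      (rename some F).IsWeightedHomogeneous (weight n d) m := fun {F m} hF => by
    rw [F.as_sum, map_sum]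
    refine IsWeightedHomogeneous.sum _ _ _ fun a ha => ?_
    rw [rename_monomial]
    refine isWeightedHomogeneous_monomial _ _ _ ?_
    rw [hF.degree_eq_sum_deg_support ha, Finsupp.weight_apply,
      Finsupp.sum_mapDomain_index (by simp) (by simp [add_mul])]
    simp [weight, Finsupp.sum]
  have h1 := (isWeightedHomogeneous_X ℂ (weight n d) none).mul (key s.snd_isHomogeneous)
  rw [show weight n d none + e = k from hk] at h1
  exact (key s.fst_isHomogeneous).add h1

end FormPair

/-! ### Sections of `kL` as pairs of forms -/

namespace Branch

variable (B : Branch n d)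

theorem eval_eq_zero_of_mem_coverIdeal {P : WCoordRing n} (hP : P ∈ B.coverIdeal)
    {v : Option (Fin (n + 1)) → ℂ} (hv : v none ^ 2 = eval (v ∘ some) B.eqn) : eval v P = 0 := by
  obtain ⟨Q, rfl⟩ := Ideal.mem_span_singleton.1 hP
  simp [eval_rename, hv]

/-- Replacing `y ^ 2` by `g` leaves `y` to the power zero or one, according to parity. Homogeneity
is a conditional clause so that inhomogeneous polynomials are covered too. -/
theorem exists_monomial_sub_mem (m : Option (Fin (n + 1)) →₀ ℕ) (c : ℂ) :
    ∃ a b : CoordRing n,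
      monomial m c - (rename some a + X none * rename some b) ∈ B.coverIdeal ∧
      ∀ e, Finsupp.weight (weight n d) m = d + e → a.IsHomogeneous (d + e) ∧ b.IsHomogeneous e := by
  have hsq : X none ^ 2 - rename some B.eqn ∈ B.coverIdeal := Ideal.subset_span rfl
  have hpow : ∀ i, X none ^ (2 * i) - rename some (B.eqn ^ i) ∈ B.coverIdeal := fun i => by
    rw [pow_mul, map_pow]
    exact Ideal.mem_of_dvd _ (sub_dvd_pow_sub_pow _ _ i) hsq
  have hm : Finsupp.single none (m none) + Finsupp.mapDomain some m.some = m := by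
    refine Finsupp.ext fun o => ?_
    cases o with
    | none =>
      rw [Finsupp.add_apply, Finsupp.mapDomain_of_notMem_range _ _ (by simp)]
      simp
    | some i =>
      rw [Finsupp.add_apply, Finsupp.mapDomain_apply (Option.some_injective _)]
      simp
  have hmon : monomial m c = X none ^ m none * rename some (monomial m.some c) := by
    rw [rename_monomial, X_pow_eq_monomial, monomial_mul, one_mul, hm]
  have hw : Finsupp.weight (weight n d) m = m.some.degree + d * m none := by
    rw [Finsupp.weight_apply, Finsupp.sum_option_index _ _ (by simp) (by simp [add_mul]),
      Finsupp.degree_apply, Finsupp.sum]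
    simp [weight]
    ring
  have hhom : ∀ i, (monomial m.some c * B.eqn ^ i).IsHomogeneous (m.some.degree + 2 * d * i) :=
    fun i => (isHomogeneous_monomial _ rfl).mul (B.isHomogeneous.pow i)
  rcases Nat.even_or_odd' (m none) with ⟨i, hi | hi⟩
  · refine ⟨monomial m.some c * B.eqn ^ i, 0, ?_, fun e he => ⟨?_, isHomogeneous_zero _ _ _⟩⟩
    · rw [hmon, hi, map_zero, mul_zero, add_zero, map_mul]
      convert B.coverIdeal.mul_mem_left (rename some (monomial m.some c)) (hpow i) using 1
      ring
    · have := hhom i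
      rwa [show m.some.degree + 2 * d * i = d + e by rw [← he, hw, hi]; ring] at this
  · refine ⟨0, monomial m.some c * B.eqn ^ i, ?_, fun e he => ⟨isHomogeneous_zero _ _ _, ?_⟩⟩
    · rw [hmon, hi, map_zero, zero_add, map_mul]
      convert B.coverIdeal.mul_mem_left (X none * rename some (monomial m.some c)) (hpow i) using 1
      ring
    · have := hhom i
      have h2 : m.some.degree + 2 * d * i = e := by
        have : d + (m.some.degree + 2 * d * i) = d + e := by rw [← he, hw, hi]; ring
        omega
      rwa [h2] at this

/-- Every polynomial in `(x, y)` is congruent to one of degree at most one in `y`. -/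
theorem exists_sub_mem (P : WCoordRing n) :
    ∃ a b : CoordRing n, P - (rename some a + X none * rename some b) ∈ B.coverIdeal ∧
      ∀ e, P.IsWeightedHomogeneous (weight n d) (d + e) →
        a.IsHomogeneous (d + e) ∧ b.IsHomogeneous e := by
  choose a b h1 h2 using fun m => B.exists_monomial_sub_mem m (coeff m P)
  refine ⟨∑ m ∈ P.support, a m, ∑ m ∈ P.support, b m, ?_, fun e he => ⟨?_, ?_⟩⟩
  · have := sum_mem (S := B.coverIdeal) (t := P.support) fun m _ => h1 m
    rw [Finset.sum_sub_distrib, Finset.sum_add_distrib, ← Finset.mul_sum, ← P.as_sum] at this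
    simpa only [map_sum] using this
  · exact IsHomogeneous.sum _ _ _ fun m hm => (h2 m e (he (mem_support_iff.1 hm))).1
  · exact IsHomogeneous.sum _ _ _ fun m hm => (h2 m e (he (mem_support_iff.1 hm))).2

/-- The section of `kL` given by a pair of forms. -/
def toSection (hk : d + e = k) : FormPair n k e →ₗ[ℂ] B.sections k where
  toFun s := ⟨Ideal.Quotient.mk B.coverIdeal s.lift,
    ⟨s.lift, s.lift_isWeightedHomogeneous hk, rfl⟩⟩
  map_add' s t := Subtype.ext <| by
    change Ideal.Quotient.mk _ _ = Ideal.Quotient.mk _ _ + Ideal.Quotient.mk _ _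
    rw [← map_add, FormPair.lift_add]
  map_smul' c s := Subtype.ext <| by
    change Ideal.Quotient.mkₐ ℂ _ _ = c • Ideal.Quotient.mkₐ ℂ _ _
    rw [← map_smul, FormPair.lift_smul]

theorem toSection_injective (hk : d + e = k) :
    Function.Injective (B.toSection hk : FormPair n k e →ₗ[ℂ] B.sections k) := by
  rw [injective_iff_map_eq_zero]
  intro s hs
  have hmem : s.lift ∈ B.coverIdeal :=
    Ideal.Quotient.eq_zero_iff_mem.1 (congrArg Subtype.val hs)
  -- Evaluation at the conjugate points `(x, y)` and `(x, -y)` separates the two parts.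
  have key : ∀ x, eval x s.fst = 0 ∧ eval x B.eqn * eval x s.snd = 0 := fun x => by
    obtain ⟨y, hy⟩ := IsAlgClosed.exists_pow_nat_eq (eval x B.eqn) zero_lt_two
    have h1 := B.eval_eq_zero_of_mem_coverIdeal hmem (v := fun o => o.elim y x) hy
    have h2 := B.eval_eq_zero_of_mem_coverIdeal hmem (v := fun o => o.elim (-y) x)
      (by rw [← neg_sq] at hy; exact hy)
    rw [FormPair.eval_lift] at h1 h2
    change eval x s.fst + y * eval x s.snd = 0 at h1
    change eval x s.fst + -y * eval x s.snd = 0 at h2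
    refine ⟨by linear_combination (h1 + h2) / 2, ?_⟩
    rw [← hy]
    linear_combination y * (h1 - h2) / 2
  have h1 : s.fst = 0 := MvPolynomial.funext fun x => by simpa using (key x).1
  have h2 : B.eqn * s.snd = 0 := MvPolynomial.funext fun x => by simpa using (key x).2
  exact Prod.ext (Subtype.ext h1) (Subtype.ext ((mul_eq_zero.1 h2).resolve_left B.ne_zero))

theorem toSection_surjective (hk : d + e = k) :
    Function.Surjective (B.toSection hk : FormPair n k e →ₗ[ℂ] B.sections k) := by
  rintro ⟨_, P, hP, rfl⟩
  subst hk
  obtain ⟨a, b, h1, h2⟩ := B.exists_sub_mem P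
  have h3 := h2 e hP
  refine ⟨⟨⟨a, h3.1⟩, ⟨b, h3.2⟩⟩, Subtype.ext ?_⟩
  exact (Ideal.Quotient.eq.2 h1).symm

theorem forGeneralMember_of_generic (hk : d + e = k) {Q : B.sections k → Prop}
    (h : Generic fun s : FormPair n k e => Q (B.toSection hk s)) : B.ForGeneralMember k Q := by
  let E := LinearEquiv.ofBijective (B.toSection hk : FormPair n k e →ₗ[ℂ] B.sections k)
    ⟨B.toSection_injective hk, B.toSection_surjective hk⟩
  obtain ⟨Φ, h1, h2, h3⟩ := h.comp_equiv E.symm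
  refine ⟨Φ, h1, h2, fun s _ hs => ?_⟩
  have h4 : Q (B.toSection hk (E.symm s)) := h3 s hs
  have h5 : B.toSection hk (E.symm s) = s := E.apply_symm_apply s
  rwa [h5] at h4

/-! ### Points of the cover -/

theorem exists_point {v : Option (Fin (n + 1)) → ℂ} (hv : v none ^ 2 = eval (v ∘ some) B.eqn)
    (hv0 : v ∘ some ≠ 0) :
    ∃ p : B.Cover, B.proj p = Projectivization.mk ℂ (v ∘ some) hv0 ∧
      ∃ t : ℂ, t ≠ 0 ∧ B.rep p = fun o => t ^ weight n d o * v o := by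
  have hvne : v ≠ 0 := by
    rintro rfl
    exact hv0 rfl
  let q : WPSpace n d := Quotient.mk (weightedSetoid n d) ⟨v, hvne⟩
  obtain ⟨t, ht⟩ : ∃ t : ℂˣ, ∀ o, q.rep o = (t : ℂ) ^ weight n d o * v o :=
    (weightedSetoid n d).symm (@Quotient.mk_out _ (weightedSetoid n d) ⟨v, hvne⟩)
  have hsome : q.rep ∘ some = (t : ℂ) • (v ∘ some) := funext fun i => by
    simp [ht, weight]
  refine ⟨⟨q, fun P hP => B.eval_eq_zero_of_mem_coverIdeal hP ?_⟩, ?_, t, t.ne_zero, funext ht⟩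
  · rw [hsome, eval_smul_of_isHomogeneous B.isHomogeneous, ht, ← hv]
    simp only [weight, Option.elim]
    ring
  · exact (Projectivization.mk_eq_mk_iff' ℂ _ _ _ _).2 ⟨t, hsome.symm⟩

/-! ### The divisor of a section -/

section Member

variable {B} (hk : d + e = k) (s : FormPair n k e)

theorem mem_memberIdeal {P : WCoordRing n} :
    P ∈ B.memberIdeal (B.toSection hk s) ↔ ∃ Q, P - s.lift * Q ∈ B.coverIdeal := by
  rw [memberIdeal, Ideal.mem_comap, Ideal.mem_span_singleton]
  constructor
  · rintro ⟨c, hc⟩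
    obtain ⟨Q, rfl⟩ := Ideal.Quotient.mk_surjective c
    exact ⟨Q, Ideal.Quotient.eq.1 (by rw [map_mul]; exact hc)⟩
  · rintro ⟨Q, hQ⟩
    exact ⟨Ideal.Quotient.mk _ Q, by rw [Ideal.Quotient.eq.2 hQ, map_mul]; rfl⟩

theorem eval_eq_zero_of_mem_memberIdeal {P : WCoordRing n}
    (hP : P ∈ B.memberIdeal (B.toSection hk s)) {v : Option (Fin (n + 1)) → ℂ}
    (hv : v none ^ 2 = eval (v ∘ some) B.eqn) (hs : eval v s.lift = 0) : eval v P = 0 := by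
  obtain ⟨Q, hQ⟩ := (mem_memberIdeal hk s).1 hP
  have := B.eval_eq_zero_of_mem_coverIdeal hQ hv
  rwa [map_sub, map_mul, hs, zero_mul, sub_zero] at this

theorem mem_member {p : B.Cover} :
    p ∈ B.member (B.toSection hk s) ↔ eval (B.rep p) s.lift = 0 :=
  ⟨fun h => h _ ((mem_memberIdeal hk s).2 ⟨1, by simp⟩),
    fun h _ hP => eval_eq_zero_of_mem_memberIdeal hk s hP (B.rep_none_sq p) h⟩

/-- Cramer's rule for `(f₁ + y f₂)(α - y β) = a + y b`, a system with determinant `F` up to sign: `F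
β = a f₂ - b f₁` and `F α = a f₁ - g b f₂`. The second divisibility follows from the first because
`F` is coprime to `f₂`. -/
theorem mem_memberIdeal_of_dvd (hF : Squarefree (s.norm B.eqn)) {P : WCoordRing n}
    {a b : CoordRing n} (hP : P - (rename some a + X none * rename some b) ∈ B.coverIdeal)
    (hdvd : s.norm B.eqn ∣ a * s.snd - b * s.fst) : P ∈ B.memberIdeal (B.toSection hk s) := by
  have hF0 := hF.ne_zero
  have hdvd' : s.norm B.eqn ∣ a * s.fst - B.eqn * b * s.snd := by
    refine (s.isRelPrime_norm_snd hF).dvd_of_dvd_mul_left (y := s.snd) ?_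
    have : s.snd * (a * s.fst - B.eqn * b * s.snd) =
        s.fst * (a * s.snd - b * s.fst) + s.norm B.eqn * b := by
      rw [FormPair.norm]
      ring
    rw [this]
    exact dvd_add (hdvd.mul_left _) (dvd_mul_right _ _)
  obtain ⟨β, hβ⟩ := hdvd
  obtain ⟨α, hα⟩ := hdvd'
  have h1 : s.fst * α - B.eqn * s.snd * β = a := by
    refine mul_left_cancel₀ hF0 ?_
    have : s.norm B.eqn * a = (s.fst ^ 2 - B.eqn * s.snd ^ 2) * a := rfl
    rw [this]
    linear_combination (-s.fst) * hα + B.eqn * s.snd * hβ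
  have h2 : s.snd * α - s.fst * β = b := by
    refine mul_left_cancel₀ hF0 ?_
    have : s.norm B.eqn * b = (s.fst ^ 2 - B.eqn * s.snd ^ 2) * b := rfl
    rw [this]
    linear_combination (-s.snd) * hα + s.fst * hβ
  refine (mem_memberIdeal hk s).2 ⟨rename some α - X none * rename some β, ?_⟩
  have h3 : (X none ^ 2 - rename some B.eqn) * (rename some s.snd * rename some β) ∈ B.coverIdeal :=
    B.coverIdeal.mul_mem_right _ (Ideal.subset_span rfl)
  convert add_mem hP h3 using 1
  rw [FormPair.lift, ← h1, ← h2]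
  simp only [map_sub, map_mul]
  ring

/-- A polynomial that vanishes at the points of `W` with `f₂ ≠ 0` belongs to the ideal of `W`. -/
theorem mem_memberIdeal_of_vanishes (hn : 1 ≤ n) (hF : Squarefree (s.norm B.eqn))
    {P : WCoordRing n}
    (hP : ∀ v : Option (Fin (n + 1)) → ℂ, v ∘ some ≠ 0 → v none ^ 2 = eval (v ∘ some) B.eqn →
      eval v s.lift = 0 → eval (v ∘ some) s.snd ≠ 0 → eval v P = 0) :
    P ∈ B.memberIdeal (B.toSection hk s) := by
  obtain ⟨a, b, hab, -⟩ := B.exists_sub_mem P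
  refine mem_memberIdeal_of_dvd hk s hF hab (dvd_of_vanishes hn hF fun x hx0 hx => ?_)
  obtain ⟨y, hy, hxy⟩ := s.exists_lift_eq_zero hx
  let v : Option (Fin (n + 1)) → ℂ := fun o => o.elim y x
  have h1 : eval v (P - (rename some a + X none * rename some b)) = 0 :=
    B.eval_eq_zero_of_mem_coverIdeal hab hy
  simp only [map_sub, map_add, map_mul, eval_X, eval_rename] at h1
  change eval v P - (eval x a + y * eval x b) = 0 at h1
  -- On `W` one has `f₁ = -y f₂`, hence `a f₂ - b f₁ = (a + y b) f₂ = P f₂`; points with `f₂ = 0`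
  -- cost nothing.
  have h2 : eval v P * eval x s.snd = 0 := by
    by_cases h : eval x s.snd = 0
    · rw [h, mul_zero]
    · rw [hP v hx0 hy (by rw [FormPair.eval_lift]; exact hxy) h, zero_mul]
  simp only [map_sub, map_mul]
  linear_combination h2 - eval x s.snd * h1 - eval x b * hxy

theorem memberIdeal_isRadical (hn : 1 ≤ n) (hF : Squarefree (s.norm B.eqn)) :
    (B.memberIdeal (B.toSection hk s)).IsRadical := by
  rintro P ⟨N, hN⟩
  refine mem_memberIdeal_of_vanishes hk s hn hF fun v _ hv hs _ => ?_
  have := eval_eq_zero_of_mem_memberIdeal hk s hN hv hs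
  rw [map_pow] at this
  exact eq_zero_of_pow_eq_zero this

theorem isBirationalOntoImage (hn : 1 ≤ n) (hF : Squarefree (s.norm B.eqn)) :
    B.IsBirationalOntoImage (B.member (B.toSection hk s)) := by
  refine ⟨e, s.snd, -s.fst, s.snd_isHomogeneous, ?_, ⟨fun w hw => hw.1, ?_⟩, ?_⟩
  · subst hk
    rw [Nat.add_comm e d]
    exact s.fst_isHomogeneous.neg
  · intro m P hP hT p hp
    refine hp P (mem_memberIdeal_of_vanishes hk s hn hF fun v hv0 hv hs h2 => ?_)
    obtain ⟨q, hq, t, ht, hrep⟩ := B.exists_point hv hv0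
    have h3 := hT q ⟨(mem_member hk s).2 ?_, ?_⟩
    · rw [hrep, eval_weighted_scale hP] at h3
      exact (mul_eq_zero.1 h3).resolve_left (pow_ne_zero _ ht)
    · rw [hrep, eval_weighted_scale (s.lift_isWeightedHomogeneous hk), hs, mul_zero]
    · rw [hq, mk_mem_hypersurface s.snd_isHomogeneous]
      exact h2
  · intro w hw _
    have := (mem_member hk s).1 hw
    rw [FormPair.eval_lift] at this
    rw [map_neg]
    linear_combination this

theorem image_member :
    B.proj '' B.member (B.toSection hk s) = hypersurface (s.norm B.eqn) := by
  have hFh := s.norm_isHomogeneous B.isHomogeneous hk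
  ext p
  constructor
  · rintro ⟨q, hq, rfl⟩
    rw [proj, mk_mem_hypersurface hFh, FormPair.norm]
    have h1 := (mem_member hk s).1 hq
    rw [FormPair.eval_lift] at h1
    simp only [map_sub, map_mul, map_pow, ← B.rep_none_sq]
    linear_combination
      (eval (B.rep q ∘ some) s.fst - B.rep q none * eval (B.rep q ∘ some) s.snd) * h1
  · intro hp
    obtain ⟨y, hy, hxy⟩ := s.exists_lift_eq_zero hp
    obtain ⟨q, hq, t, ht, hrep⟩ := B.exists_point (v := fun o => o.elim y p.rep) hy p.rep_nonzero
    refine ⟨q, (mem_member hk s).2 ?_, hq.trans p.mk_rep⟩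
    rw [hrep, eval_weighted_scale (s.lift_isWeightedHomogeneous hk), FormPair.eval_lift]
    exact mul_eq_zero_of_right _ hxy

/-- A preimage is stable under `y ↦ -y`, so `f₁` would vanish wherever `F` does. Then `F` divides
the nonzero form `f₁`, although `2k > k`. -/
theorem not_isDoubleCoverOfHypersurface (hn : 1 ≤ n) (hF : Squarefree (s.norm B.eqn))
    (hg : IsRelPrime s.fst B.eqn) :
    ¬ B.IsDoubleCoverOfHypersurface (B.member (B.toSection hk s)) := by
  rintro ⟨m, a, ha, -, hW⟩
  have hdvd : s.norm B.eqn ∣ s.fst := dvd_of_vanishes hn hF fun x hx0 hx => by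
    obtain ⟨y, hy, hxy⟩ := s.exists_lift_eq_zero hx
    obtain ⟨q, hq, t, ht, hrep⟩ := B.exists_point (v := fun o => o.elim y x) hy hx0
    have hy' : (-y) ^ 2 = eval x B.eqn := by rw [neg_sq, hy]
    obtain ⟨q', hq', t', ht', hrep'⟩ := B.exists_point (v := fun o => o.elim (-y) x) hy' hx0
    have h1 : q ∈ B.member (B.toSection hk s) := by
      rw [mem_member, hrep, eval_weighted_scale (s.lift_isWeightedHomogeneous hk),
        FormPair.eval_lift]
      exact mul_eq_zero_of_right _ hxy
    have h2 : q' ∈ B.member (B.toSection hk s) := by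
      rw [hW, Set.mem_preimage] at h1 ⊢
      rw [hq] at h1
      rw [hq']
      exact h1
    rw [mem_member, hrep', eval_weighted_scale (s.lift_isWeightedHomogeneous hk),
      FormPair.eval_lift] at h2
    have h3 : eval x s.fst + -y * eval x s.snd = 0 :=
      (mul_eq_zero.1 h2).resolve_left (pow_ne_zero _ ht')
    linear_combination (hxy + h3) / 2
  have hd := B.pos
  have hf : s.fst ≠ 0 := fun h => by
    rw [h] at hg
    exact not_isUnit_of_isHomogeneous B.isHomogeneous (by omega) (hg (dvd_zero _) dvd_rfl)
  have hdeg := s.fst_isHomogeneous.totalDegree hf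
  obtain ⟨c, hc⟩ := hdvd
  have hc0 : c ≠ 0 := by
    rintro rfl
    exact hf (by rw [hc, mul_zero])
  rw [hc, totalDegree_mul_of_isDomain hF.ne_zero hc0,
    (s.norm_isHomogeneous B.isHomogeneous hk).totalDegree hF.ne_zero] at hdeg
  omega

end Member

end Branch

/-! ### The discriminant of a general section -/

namespace FormPair

/-- The genericity conditions on a pair of forms: `f₁ = 0` has no common component with `g = 0`,
the norm is squarefree, and `f₁ = f₂ = 0` is a smooth complete intersection without components
in `g = 0`. -/
structure IsGeneral (g : CoordRing n) (s : FormPair n k e) : Prop where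
  isRelPrime : IsRelPrime s.fst g
  squarefree : Squarefree (s.norm g)
  exists_minor : ∀ x, x ≠ 0 → eval x s.fst = 0 → eval x s.snd = 0 →
    ∃ i j, eval x (pderiv i s.fst) * eval x (pderiv j s.snd) ≠
      eval x (pderiv j s.fst) * eval x (pderiv i s.snd)
  dense : ∀ h : CoordRing n,
    (∀ x, eval x s.fst = 0 → eval x s.snd = 0 → eval x (h * g) = 0) →
      ∀ x, x ≠ 0 → eval x s.fst = 0 → eval x s.snd = 0 → eval x h = 0

/-- For `e = 0` the form `f₂` is constant, and it is nonzero since otherwise `F = f₁ ^ 2`. Hence `Z`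
is empty. -/
theorem eval_snd_ne_zero {g : CoordRing n} (s : FormPair n k 0) (hk : 0 < k)
    (hF : Squarefree (s.norm g)) (x : Fin (n + 1) → ℂ) : eval x s.snd ≠ 0 := fun h => by
  have h0 : ∀ y, eval 0 s.snd = eval y s.snd := fun y => by
    simpa using eval_smul_of_isHomogeneous s.snd_isHomogeneous 0 y
  have h1 : s.snd = 0 := MvPolynomial.funext fun y => by rw [← h0, h0 x, h, map_zero]
  refine not_isUnit_of_isHomogeneous s.fst_isHomogeneous hk (hF _ ⟨1, ?_⟩)
  rw [norm, h1]
  ring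

theorem generic_isGeneral {g : CoordRing n} (hn : 1 ≤ n) (hg : g.IsHomogeneous (2 * d))
    (hg0 : g ≠ 0) (hd : 0 < d) (hk : d + e = k) :
    Generic fun s : FormPair n k e => s.IsGeneral g := by
  obtain ⟨n, rfl⟩ := Nat.exists_eq_add_of_le' hn
  have h1 := (generic_isRelPrime (k := k) (e := e) hg hg0 hd).and
    (generic_squarefree hg hg0 hd hk)
  rcases Nat.eq_zero_or_pos e with rfl | he
  · refine h1.mono fun s hs => ⟨hs.1, hs.2, fun x _ _ h => ?_, fun _ _ x _ _ h => ?_⟩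
    all_goals exact absurd h (s.eval_snd_ne_zero (by omega) hs.2 x)
  have h2 := h1.and (generic_smooth (n := n + 1) hd he hk)
  have hminor : ∀ s : FormPair (n + 1) k e,
      (∀ x, eval x s.fst = 0 → eval x s.snd = 0 →
        (∀ i j, eval x (pderiv i s.fst) * eval x (pderiv j s.snd) =
          eval x (pderiv j s.fst) * eval x (pderiv i s.snd)) → x = 0) →
      ∀ x, x ≠ 0 → eval x s.fst = 0 → eval x s.snd = 0 →
        ∃ i j, eval x (pderiv i s.fst) * eval x (pderiv j s.snd) ≠
          eval x (pderiv j s.fst) * eval x (pderiv i s.snd) := fun s hs x hx h1 h2 => by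
    by_contra! h
    exact hx (hs x h1 h2 h)
  rcases n with _ | n
  · refine h2.mono fun s hs => ⟨hs.1.1, hs.1.2, hminor s hs.2, fun _ _ x hx h1 h2 => ?_⟩
    exfalso
    -- On the projective line `Z` is empty: by Euler's relation both gradients at a common zero `x ≠
    -- 0` annihilate `x`, so the Jacobian minor vanishes, against smoothness.
    have euler : ∀ {f : CoordRing 1} {m : ℕ}, f.IsHomogeneous m → eval x f = 0 →
        x 0 * eval x (pderiv 0 f) + x 1 * eval x (pderiv 1 f) = 0 := fun {f m} hf hf0 => by
      have := congrArg (eval x) hf.sum_X_mul_pderiv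
      simpa [Fin.sum_univ_two, hf0] using this
    have e1 := euler s.fst_isHomogeneous h1
    have e2 := euler s.snd_isHomogeneous h2
    set a₀ := eval x (pderiv 0 s.fst)
    set a₁ := eval x (pderiv 1 s.fst)
    set b₀ := eval x (pderiv 0 s.snd)
    set b₁ := eval x (pderiv 1 s.snd)
    have hdet : a₀ * b₁ = a₁ * b₀ := by
      by_contra hne
      have hne := sub_ne_zero.2 hne
      refine hx (funext fun i => (mul_eq_zero.1 (?_ : (a₀ * b₁ - a₁ * b₀) * x i = 0)).resolve_left
        hne)
      fin_cases i
      · change (a₀ * b₁ - a₁ * b₀) * x 0 = 0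
        linear_combination b₁ * e1 - a₁ * e2
      · change (a₀ * b₁ - a₁ * b₀) * x 1 = 0
        linear_combination a₀ * e2 - b₀ * e1
    obtain ⟨i, j, hij⟩ := hminor s hs.2 x hx h1 h2
    refine hij ?_
    fin_cases i <;> fin_cases j
    exacts [rfl, hdet, hdet.symm, rfl]
  · refine (h2.and (generic_no_component (n := n) hg hg0 hd (by omega) he)).mono fun s hs =>
      ⟨hs.1.1.1, hs.1.1.2, hminor s hs.1.2, fun p hp x _ h1 h2 => hs.2 p hp x h1 h2⟩

variable {g : CoordRing n} (s : FormPair n k e)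

theorem pderiv_norm (i : Fin (n + 1)) :
    pderiv i (s.norm g) = 2 * s.fst * pderiv i s.fst - pderiv i g * s.snd ^ 2 -
      2 * g * s.snd * pderiv i s.snd := by
  simp only [norm, map_sub, Derivation.leibniz, Derivation.leibniz_pow, smul_eq_mul, nsmul_eq_mul]
  push_cast
  ring

variable {s}

/-- At a common point `f₁ = 0`, so only the term `-f₂ ^ 2 ∇g` of `∇F` survives. -/
theorem isEverywhereTangent (hg : IsRelPrime s.fst g) : IsEverywhereTangent (s.norm g) g := by
  refine ⟨s.isRelPrime_norm hg, fun p hp => ⟨- eval p.rep s.snd ^ 2, ?_⟩⟩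
  have h1 : eval p.rep (s.norm g) = 0 := hp.1
  have h2 : eval p.rep g = 0 := hp.2
  have h3 : eval p.rep s.fst = 0 := by
    simpa [norm, h2] using h1
  funext i
  simp [grad, pderiv_norm, h2, h3]
  ring

theorem cutsOutContactLocus (hg : IsRelPrime s.fst g) : CutsOutContactLocus s.fst (s.norm g) g := by
  refine ⟨hg, le_antisymm ?_ ?_⟩ <;> rw [Ideal.span_le]
  · rintro _ (rfl | rfl)
    · exact sub_mem (Ideal.subset_span (by simp))
        (Ideal.mul_mem_right _ _ (Ideal.subset_span (by simp)))
    · exact Ideal.subset_span (by simp)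
  · rintro _ (rfl | rfl)
    · have h1 : s.norm g + g * s.snd ^ 2 ∈ Ideal.span {s.norm g, g} :=
        add_mem (Ideal.subset_span (by simp))
          (Ideal.mul_mem_right _ _ (Ideal.subset_span (by simp)))
      rwa [norm, sub_add_cancel] at h1
    · exact Ideal.subset_span (by simp)

/-! ### The double locus `f₁ = f₂ = 0` -/

section DoubleLocus

variable {p : PSpace n}

theorem grad_norm_eq_zero (h1 : p ∈ hypersurface s.fst) (h2 : p ∈ hypersurface s.snd) :
    grad (s.norm g) p = 0 := by
  have h1 : eval p.rep s.fst = 0 := h1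
  have h2 : eval p.rep s.snd = 0 := h2
  funext i
  simp [grad, pderiv_norm, h1, h2]

theorem hessian_norm (h1 : p ∈ hypersurface s.fst) (h2 : p ∈ hypersurface s.snd)
    (i j : Fin (n + 1)) :
    hessian (s.norm g) p i j =
      2 * (grad s.fst p i * grad s.fst p j - eval p.rep g * (grad s.snd p i * grad s.snd p j)) := by
  have h1 : eval p.rep s.fst = 0 := h1
  have h2 : eval p.rep s.snd = 0 := h2
  simp [hessian, grad, pderiv_norm, Derivation.leibniz, Derivation.leibniz_pow, h1, h2]
  ring

namespace IsGeneral

theorem exists_grad_minor (hs : s.IsGeneral g) (h1 : p ∈ hypersurface s.fst) (h2 : p ∈ hypersurface s.snd) :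
    ∃ i j, grad s.fst p i * grad s.snd p j - grad s.fst p j * grad s.snd p i ≠ 0 := by
  obtain ⟨i, j, hij⟩ := hs.exists_minor p.rep p.rep_nonzero h1 h2
  exact ⟨i, j, sub_ne_zero.2 hij⟩

theorem isSmoothCompleteIntersection (hs : s.IsGeneral g) : IsSmoothCompleteIntersection s.fst s.snd := by
  refine ⟨s.isRelPrime_fst_snd hs.squarefree, fun p hp => ?_⟩
  obtain ⟨i, j, hij⟩ := hs.exists_grad_minor hp.1 hp.2
  rw [LinearIndependent.pair_iff]
  intro α β h
  have hi : α * grad s.fst p i + β * grad s.snd p i = 0 := congrFun h i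
  have hj : α * grad s.fst p j + β * grad s.snd p j = 0 := congrFun h j
  constructor
  · refine (mul_eq_zero.1 (?_ : _ * α = 0)).resolve_left hij
    linear_combination grad s.snd p j * hi - grad s.snd p i * hj
  · refine (mul_eq_zero.1 (?_ : _ * β = 0)).resolve_left hij
    linear_combination grad s.fst p i * hj - grad s.fst p j * hi

theorem isDoublePoint (hs : s.IsGeneral g) (h1 : p ∈ hypersurface s.fst) (h2 : p ∈ hypersurface s.snd) :
    IsDoublePoint (s.norm g) p := by
  refine ⟨?_, grad_norm_eq_zero h1 h2, fun h0 => ?_⟩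
  · have h1 : eval p.rep s.fst = 0 := h1
    have h2 : eval p.rep s.snd = 0 := h2
    simp [hypersurface, norm, h1, h2]
  · obtain ⟨i, j, hij⟩ := hs.exists_grad_minor h1 h2
    have h3 : ∀ i j, grad s.fst p i * grad s.fst p j -
        eval p.rep g * (grad s.snd p i * grad s.snd p j) = 0 := fun i j => by
      have := hessian_norm (g := g) h1 h2 i j
      rw [h0, Matrix.zero_apply] at this
      exact (mul_eq_zero.1 this.symm).resolve_left two_ne_zero
    -- This combination of Hessian entries cancels the `g` terms and leaves the square of the minor,
    -- so the argument also holds on `B`.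
    refine hij (eq_zero_of_pow_eq_zero (n := 2) ?_)
    linear_combination grad s.snd p j ^ 2 * h3 i i - 2 * grad s.snd p i * grad s.snd p j * h3 i j +
      grad s.snd p i ^ 2 * h3 j j

/-- The Hessian factors through a two-dimensional space, and its `(i, j)` principal minor is `-4 g`
times the square of the Jacobian minor. -/
theorem isOrdinaryDoublePoint (hs : s.IsGeneral g) (h1 : p ∈ hypersurface s.fst) (h2 : p ∈ hypersurface s.snd)
    (h3 : p ∉ hypersurface g) : IsOrdinaryDoublePoint (s.norm g) p := by
  refine ⟨hs.isDoublePoint h1 h2, le_antisymm ?_ ?_⟩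
  · let U : Matrix (Fin (n + 1)) (Fin 2) ℂ := Matrix.of fun i => ![grad s.fst p i, grad s.snd p i]
    let V : Matrix (Fin 2) (Fin (n + 1)) ℂ := Matrix.of
      ![fun j => 2 * grad s.fst p j, fun j => -2 * eval p.rep g * grad s.snd p j]
    have hUV : hessian (s.norm g) p = U * V := by
      ext i j
      rw [hessian_norm h1 h2, Matrix.mul_apply, Fin.sum_univ_two]
      simp [U, V]
      ring
    rw [hUV]
    exact (Matrix.rank_mul_le_left U V).trans (Matrix.rank_le_width U)
  · obtain ⟨i, j, hij⟩ := hs.exists_grad_minor h1 h2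
    have h3 : eval p.rep g ≠ 0 := h3
    have h4 := (hessian (s.norm g) p).rank_submatrix_le ![i, j] ![i, j]
    rw [Matrix.rank_of_det_ne_zero] at h4
    · simpa using h4
    · rw [Matrix.det_fin_two]
      simp only [Matrix.submatrix_apply, Matrix.cons_val_zero, Matrix.cons_val_one,
        hessian_norm h1 h2]
      have h5 : -4 * eval p.rep g *
          (grad s.fst p i * grad s.snd p j - grad s.fst p j * grad s.snd p i) ^ 2 ≠ 0 :=
        mul_ne_zero (mul_ne_zero (by norm_num) h3) (pow_ne_zero _ hij)
      intro h
      refine h5 ?_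
      linear_combination h

/-- If `h` vanishes on `Z \ B`, then `h * g` vanishes on all of `Z`, and `dense` removes the factor
`g`. -/
theorem isDenseIn_diff (hs : s.IsGeneral g) (hg : g.IsHomogeneous (2 * d)) (hd : 0 < d) :
    IsDenseIn ((hypersurface s.fst ∩ hypersurface s.snd) \ hypersurface g)
      (hypersurface s.fst ∩ hypersurface s.snd) := by
  refine ⟨Set.sdiff_subset, fun m h hh hT p hp => ?_⟩
  refine hs.dense h (fun x h1 h2 => ?_) p.rep p.rep_nonzero hp.1 hp.2
  rw [map_mul]
  by_cases hx : x = 0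
  · have := eval_smul_of_isHomogeneous hg 0 0
    rw [zero_smul, zero_pow (by omega), zero_mul] at this
    rw [hx, this, mul_zero]
  by_cases h3 : eval x g = 0
  · rw [h3, mul_zero]
  have h4 : Projectivization.mk ℂ x hx ∈ hypersurface h := hT
    ⟨⟨(mk_mem_hypersurface s.fst_isHomogeneous x hx).2 h1,
      (mk_mem_hypersurface s.snd_isHomogeneous x hx).2 h2⟩,
      fun h => h3 ((mk_mem_hypersurface hg x hx).1 h)⟩
  rw [(mk_mem_hypersurface hh x hx).1 h4, zero_mul]

end IsGeneral

end DoubleLocus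

end FormPair

end DoubleCover

end

theorem mainTheorem9 (n d k : ℕ) (hn : 1 ≤ n) (hdk : d ≤ k) (B : DoubleCover.Branch n d) :
    B.ForGeneralMember k fun s =>
      -- `W` is reduced, is not a double cover of a hypersurface, and is mapped birationally by `π`
      (B.memberIdeal s).IsRadical ∧
      ¬ B.IsDoubleCoverOfHypersurface (B.member s) ∧
      B.IsBirationalOntoImage (B.member s) ∧
      -- the image is the (reduced) hypersurface `F = 0` of degree `2k`
      ∃ F : DoubleCover.CoordRing n, F.IsHomogeneous (2 * k) ∧ Squarefree F ∧
        B.proj '' B.member s = DoubleCover.hypersurface F ∧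
        DoubleCover.IsEverywhereTangent F B.eqn ∧
        -- `Z` is the complete intersection `f₁ = f₂ = 0`
        ∃ f₁ f₂ : DoubleCover.CoordRing n, f₁.IsHomogeneous k ∧ f₂.IsHomogeneous (k - d) ∧
          DoubleCover.IsSmoothCompleteIntersection f₁ f₂ ∧
          DoubleCover.HasOrdinaryDoubleLocus F
            (DoubleCover.hypersurface f₁ ∩ DoubleCover.hypersurface f₂) ∧
          DoubleCover.IsDenseIn
            ((DoubleCover.hypersurface f₁ ∩ DoubleCover.hypersurface f₂) \
              DoubleCover.hypersurface B.eqn)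
            (DoubleCover.hypersurface f₁ ∩ DoubleCover.hypersurface f₂) ∧
          (∀ p ∈ DoubleCover.hypersurface f₁ ∩ DoubleCover.hypersurface f₂,
            p ∉ DoubleCover.hypersurface B.eqn → DoubleCover.IsOrdinaryDoublePoint F p) ∧
          -- the hypersurface `a = 0` of degree `k` contains `Z` and cuts out the contact locus on `B`
          ∃ a : DoubleCover.CoordRing n, a.IsHomogeneous k ∧
            DoubleCover.hypersurface f₁ ∩ DoubleCover.hypersurface f₂ ⊆
              DoubleCover.hypersurface a ∧
            DoubleCover.CutsOutContactLocus a F B.eqn := by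
  obtain ⟨e, rfl⟩ := Nat.exists_eq_add_of_le hdk
  refine B.forGeneralMember_of_generic rfl
    ((DoubleCover.FormPair.generic_isGeneral hn B.isHomogeneous B.ne_zero B.pos rfl).mono
      fun s hs => ?_)
  have hk : d + e - d = e := by omega
  have hdense := hs.isDenseIn_diff B.isHomogeneous B.pos
  refine ⟨DoubleCover.Branch.memberIdeal_isRadical rfl s hn hs.squarefree,
    DoubleCover.Branch.not_isDoubleCoverOfHypersurface rfl s hn hs.squarefree hs.isRelPrime,
    DoubleCover.Branch.isBirationalOntoImage rfl s hn hs.squarefree,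
    s.norm B.eqn, s.norm_isHomogeneous B.isHomogeneous rfl, hs.squarefree,
    DoubleCover.Branch.image_member rfl s, DoubleCover.FormPair.isEverywhereTangent hs.isRelPrime,
    s.fst, s.snd, s.fst_isHomogeneous, ?_, hs.isSmoothCompleteIntersection,
    ⟨fun p hp => hs.isDoublePoint hp.1 hp.2, fun p hp => hp.1, fun m h hh hT => ?_⟩, hdense,
    fun p hp => hs.isOrdinaryDoublePoint hp.1 hp.2,
    s.fst, s.fst_isHomogeneous, Set.inter_subset_left,
    DoubleCover.FormPair.cutsOutContactLocus hs.isRelPrime⟩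
  · rw [hk]
    exact s.snd_isHomogeneous
  -- The ordinary double points contain the dense set `Z \ B`.
  · exact hdense.2 m h hh fun p hp => hT ⟨hp.1, hs.isOrdinaryDoublePoint hp.1.1 hp.1.2 hp.2⟩
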